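/- Let $X>0$ be a random variable with law $\nu$, let $(X_i)_{i\ge1}$ be i.i.d. copies of $X$, and for $x\ge 0$ let $T^x_n=x+X_1+\dots+X_n$ ($n\ge0$) be the renewal epochs with delay $x$. Let $B^x_t$ ($t\ge0$) be the residual life, i.e. $B^x_t=T^x_m-t$ where $m$ is the least index with $T^x_m>t$, and let $U^x(A)=\mathbb E\sum_{n\ge0}\mathbf 1_A(T^x_n)$ be the renewal measure on Borel sets $A\subset(0,\infty)$. Let $\|\mu-\mu'\|_{TV}=\sup_A|\mu(A)-\mu'(A)|$. Suppose that $X$ has a uniform component: there are $c\ge L>0$ and $\tilde\eta\in(0,1)$ with $$\mathbb P(X\in[t_1,t_2])\ \ge\ \frac{\tilde\eta}{2L}\int_{t_1}^{t_2}\mathbf 1_{[c-L,c+L]}(r)\,dr\qquad\text{for all }0\le t_1\le t_2,$$ put $\eta=\tilde\eta/2$, and suppose $\mathbb P(X>c+L)>0$. Write $\mathcal L(b)=\mathbb E(e^{bX})$ and let $\bar{\mathcal L}_{c+L}(s)\in[0,\infty]$ be the Laplace transform $\mathbb E(e^{sM})$ of the maximum $M$ of two independent copies of $X$ which are both conditioned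 on being $>c+L$. Let $\beta>0$ and $\delta\in[0,1)$ be such that $\mathcal L((1+\delta)\beta)<\infty$, set $$R=\frac1{2\beta}\log\frac{\mathcal L((1+\delta)\beta)}{1-\mathcal L(-(1-\delta)\beta)},\qquad p=\eta^{\lceil R/L\rceil},$$ and let $\theta\in(0,1]$ be such that $A:=e^{\theta\beta(R+\lfloor R/L\rfloor c)}\,\bar{\mathcal L}_{c+L}(\theta\beta)$ satisfies $A(1-p)<1$. Then for every $\gamma<\beta\theta\delta$ there is a constant $C$, which does not depend on $x$, $t$, $D$ and is at most the explicit constant $$\frac{p\,A}{1-A(1-p)},$$ such that for all $x\ge0$ and $t\ge0$ $$\|\mathrm{law}(B^x_t)-\mathrm{law}(B^0_t)\|_{TV}\le e^{\beta\theta x}\,C\,e^{-\gamma t},$$ and for all Borel sets $D\subset(0,\infty)$ $$|U^x(t+D)-U^0(t+D)|\le 2e^{\beta\theta x}\,C\,e^{-\gamma t}\,\bigl(U^0((0,\sup D))+1\bigr).$$ Moreover $C$ is bounded by a number which depends only on $\eta,L,c,\gamma$ and on $\beta,\delta,\theta$, not on the law of $X$. Here all renewal measures that occur are finite if $D$ is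 bounded; in general the last inequality is understood as the two inequalities $U^x(t+D)\le U^0(t+D)+K$ and $U^0(t+D)\le U^x(t+D)+K$ in $[0,\infty]$, where $K$ is its right-hand side. -/

import Mathlib

open MeasureTheory ProbabilityTheory

namespace Renewal

noncomputable section

/-- The total variation distance `sup_A |μ(A) - ν(A)|` of two probability measures on `ℝ`,
the supremum running over all Borel sets. -/
def tvDist (μ ν : Measure ℝ) : ℝ :=
  ⨆ A : {A : Set ℝ // MeasurableSet A}, |μ.real A.1 - ν.real A.1|

section Paths

variable {Ω : Type*}

/-- The renewal epoch `T_n = x + X_1 + ⋯ + X_n` with delay `x`; the inter-arrival time `X_{i+1}`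
is `X i`. -/
def epoch (X : ℕ → Ω → ℝ) (x : ℝ) (n : ℕ) (ω : Ω) : ℝ :=
  x + ∑ i ∈ Finset.range n, X i ω

/-- The index `N_t + 1` of the first epoch strictly after time `t`
(it is `0` if already the delay exceeds `t`). -/
def nextIndex (X : ℕ → Ω → ℝ) (x t : ℝ) (ω : Ω) : ℕ :=
  sInf {n : ℕ | t < epoch X x n ω}

/-- The residual life `B_t = T_{N_t + 1} - t` of the renewal process with delay `x`. -/
def residualLife (X : ℕ → Ω → ℝ) (x t : ℝ) (ω : Ω) : ℝ :=
  epoch X x (nextIndex X x t ω) ω - t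

variable [MeasurableSpace Ω]

/-- The renewal measure `U(A) = E ∑_{n ≥ 0} 1_A(T_n)` on the Borel sets `A` of `(0, ∞)`,
seen as a measure on `ℝ` that is carried by `(0, ∞)`. -/
def renewalMeasure (P : Measure Ω) (X : ℕ → Ω → ℝ) (x : ℝ) : Measure ℝ :=
  (Measure.sum fun n : ℕ => P.map (epoch X x n)).restrict (Set.Ioi 0)

end Paths

/-- A law `ν` has a uniform component of mass `m` on the interval `[c - L, c + L]`. -/
def HasUniformComponent (ν : Measure ℝ) (c L m : ℝ) : Prop :=
  ∀ t₁ t₂ : ℝ, 0 ≤ t₁ → t₁ ≤ t₂ →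
    m / (2 * L) * ∫ r in t₁..t₂, (Set.Icc (c - L) (c + L)).indicator (fun _ => (1 : ℝ)) r
      ≤ ν.real (Set.Icc t₁ t₂)

/-- The Laplace transform `E (exp (b X))` of a random variable `X` of law `ν`. -/
def laplace (ν : Measure ℝ) (b : ℝ) : ℝ :=
  ∫ y, Real.exp (b * y) ∂ν

/-- The Laplace transform, with values in `[0, ∞]`, of the maximum of two independent random
variables which both have the law `ν` conditioned on `(a, ∞)`. -/
def laplaceMax (ν : Measure ℝ) (a s : ℝ) : ENNReal :=
  ∫⁻ p : ℝ × ℝ, ENNReal.ofReal (Real.exp (s * max p.1 p.2))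
    ∂((ν[|Set.Ioi a]).prod (ν[|Set.Ioi a]))

/-- The distance
`R(δ, β) = (2 β)⁻¹ log (E (exp ((1 + δ) β X)) / (1 - E (exp (-(1 - δ) β X))))`. -/
def radius (ν : Measure ℝ) (δ β : ℝ) : ℝ :=
  1 / (2 * β) * Real.log (laplace ν ((1 + δ) * β) / (1 - laplace ν (-((1 - δ) * β))))

/-- The quantity `exp (s (R + ⌊R / L⌋ c)) * laplaceMax (c + L) s`, with values in `[0, ∞]`. -/
def attemptCost (ν : Measure ℝ) (c L R s : ℝ) : ENNReal :=
  ENNReal.ofReal (Real.exp (s * (R + (⌊R / L⌋₊ : ℝ) * c))) * laplaceMax ν (c + L) s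

/-- The smallness condition on `θ`:
`exp (θ β (R + ⌊R / L⌋ c)) * laplaceMax (c + L) (θ β) * (1 - η ^ ⌈R / L⌉) < 1`, `R = R(δ, β)`. -/
def Admissible (ν : Measure ℝ) (η c L β δ θ : ℝ) : Prop :=
  attemptCost ν c L (radius ν δ β) (θ * β) *
    ENNReal.ofReal (1 - η ^ ⌈radius ν δ β / L⌉₊) < 1

/-- The explicit constant
`η ^ ⌈R / L⌉ A / (1 - A (1 - η ^ ⌈R / L⌉))`, where `R = R(δ, β)` and
`A = exp (θ β (R + ⌊R / L⌋ c)) * laplaceMax (c + L) (θ β)`. -/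
def couplingConstant (ν : Measure ℝ) (η c L β δ θ : ℝ) : ℝ :=
  η ^ ⌈radius ν δ β / L⌉₊ * (attemptCost ν c L (radius ν δ β) (θ * β)).toReal /
    (1 - (attemptCost ν c L (radius ν δ β) (θ * β)).toReal *
      (1 - η ^ ⌈radius ν δ β / L⌉₊))

/-- The open interval `(0, sup D)`, the supremum being taken in the extended real line. -/
def intervalToSup (D : Set ℝ) : Set ℝ :=
  {s : ℝ | 0 < s ∧ (s : EReal) < ⨆ d ∈ D, (d : EReal)}

end

end Renewal

/-! For a Borel set A put F(u) = P(B^0_u ∈ A) for every real u. A delay only shifts time, so P(B^x_t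
∈ A) = F(t - x); likewise U^x(t + D) = G(t - x) with G = `expectedCount ν D`. Conditioning on the
first jump gives F(u) = ∫ F(u - y) dν(y) for u ≥ 0, and the same for G, which for bounded D takes
values in [0, 1] after division by U^0((0, sup D)) + 1. Both claims thus reduce to a bound on |F(t -
x) - F(t)| for an arbitrary [0, 1]-valued solution (`IsRenewalSolution`).

The coupling of two renewal processes becomes an estimate of the oscillation of F. Let a and b be
the times left to the two processes; the larger belongs to the one that lags behind. If |a - b| > R,
only that one jumps, and R is chosen so that the exponential weight does not grow on average
(`abs_sub_le_of_drift`). If |a - b| ≤ R, both jump, up to ⌈R/L⌉ times. In each round a mass η of the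
two jump laws is matched with a relative shift of at most L, and the remaining masses are made
independent, at a cost controlled by `laplaceMax` (`abs_sub_le_of_shift`, `abs_sub_le_of_attempts`).
If every round succeeds, which has weight p, the processes meet and the difference is 0. The
constant C = pA/(1 - A(1 - p)) is the fixed point of C ↦ ((1 - p)C + p)A.

No coupling time has to be constructed: a bound C · `weight` + κ(e^a + e^b) implies itself with κ
replaced by ρκ, for a fixed ρ < 1 (`contraction`). It holds trivially for κ = 1, and iteration
removes the error (`abs_sub_le_weight`).

Since γ < βθδ, the exponent θ may be lowered to κθ with κ < 1. Jensen's inequality then keeps A(1 -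
p) away from 1 uniformly in the law (`exists_couplingData`). -/

namespace Renewal

/-! ### Jensen's inequality and comparison of measures on the line -/

/-- Jensen's inequality for the concave power `x ↦ x ^ κ`. -/
theorem lintegral_rpow_le_rpow_lintegral {α : Type*} [MeasurableSpace α] {μ : Measure α}
    [IsProbabilityMeasure μ] {f : α → ENNReal} (hf : AEMeasurable f μ) {κ : ℝ} (h0 : 0 ≤ κ)
    (h1 : κ ≤ 1) : ∫⁻ a, f a ^ κ ∂μ ≤ (∫⁻ a, f a ∂μ) ^ κ := by
  rcases h0.eq_or_lt with rfl | h0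
  · simp
  have h := eLpNorm'_le_eLpNorm'_of_exponent_le h0 h1 μ hf.aestronglyMeasurable
  simp only [eLpNorm', enorm_eq_self, ENNReal.rpow_one, div_one] at h
  have h2 := ENNReal.rpow_le_rpow h h0.le
  rwa [← ENNReal.rpow_mul, one_div, inv_mul_cancel₀ h0.ne', ENNReal.rpow_one] at h2

/-- A probability measure on `ℝ` dominates every measure that it dominates on half-open
intervals. -/
theorem le_of_forall_Ioc {μ ν : Measure ℝ} [IsProbabilityMeasure ν]
    (h : ∀ a b : ℝ, μ (Set.Ioc a b) ≤ ν (Set.Ioc a b)) : μ ≤ ν := by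
  -- The outer measure of a Stieltjes function is an infimum over covers by half-open intervals, so
  -- comparison on these suffices.
  have key : μ.toOuterMeasure ≤ (cdf ν).outer := by
    refine OuterMeasure.le_ofFunction.2 fun s => ?_
    rw [StieltjesFunction.length_eq]
    refine le_iInf fun a => le_iInf fun b => le_iInf fun hs => ?_
    have hs' : s ⊆ Set.Ioc a b := by
      rwa [show (botSet : Set ℝ) = ∅ from
        Set.eq_empty_of_forall_notMem fun x hx => not_isBot x hx, Set.sdiff_empty] at hs
    calc μ s ≤ μ (Set.Ioc a b) := measure_mono hs'
      _ ≤ ν (Set.Ioc a b) := h a b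
      _ = _ := by
        conv_lhs => rw [← measure_cdf ν]
        exact (cdf ν).measure_Ioc a b
  refine Measure.le_iff.2 fun s hs => ?_
  have := key s
  conv_rhs => rw [← measure_cdf ν]
  rw [StieltjesFunction.measure_def]
  exact this

/-! ### The uniform component as a measure inequality -/

/-- The measure `a • Leb` on the interval `[u, v]`. -/
noncomputable def uniformPart (a u v : ℝ) : Measure ℝ :=
  ENNReal.ofReal a • volume.restrict (Set.Icc u v)

theorem uniformPart_apply_univ {a u v : ℝ} (ha : 0 ≤ a) :
    uniformPart a u v Set.univ = ENNReal.ofReal (a * (v - u)) := by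
  simp [uniformPart, ENNReal.ofReal_mul ha]

instance {a u v : ℝ} : IsFiniteMeasure (uniformPart a u v) :=
  ⟨by simpa [uniformPart] using ENNReal.mul_lt_top ENNReal.ofReal_lt_top ENNReal.ofReal_lt_top⟩

theorem uniformPart_mono {a u v u' v' : ℝ} (h : Set.Icc u v ⊆ Set.Icc u' v') :
    uniformPart a u v ≤ uniformPart a u' v' := by
  unfold uniformPart
  gcongr

theorem uniformPart_Ioi {a u v w : ℝ} (h : v ≤ w) : uniformPart a u v (Set.Ioi w) = 0 := by
  have : Set.Ioi w ∩ Set.Icc u v = ∅ := by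
    ext x
    simp only [Set.mem_inter_iff, Set.mem_Ioi, Set.mem_Icc, Set.mem_empty_iff_false, iff_false]
    intro hx
    linarith [hx.1, hx.2.2]
  simp [uniformPart, Measure.restrict_apply measurableSet_Ioi, this]

theorem integral_uniformPart_translate {a u v σ : ℝ} (f : ℝ → ℝ) :
    ∫ y, f y ∂(uniformPart a (u + σ) (v + σ)) = ∫ z, f (z + σ) ∂(uniformPart a u v) := by
  simp only [uniformPart, integral_smul_measure]
  congr 1
  have := (measurePreserving_add_right (volume : Measure ℝ) σ).setIntegral_preimage_emb
    (measurableEmbedding_addRight σ) f (Set.Icc (u + σ) (v + σ))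
  rw [← this]
  simp

theorem HasUniformComponent.uniformPart_le {ν : Measure ℝ} [IsProbabilityMeasure ν] {c L m : ℝ}
    (h : HasUniformComponent ν c L m) (hm : 0 ≤ m) (hL : 0 < L) (hLc : L ≤ c) :
    uniformPart (m / (2 * L)) (c - L) (c + L) ≤ ν := by
  have hIcc : ∀ a b : ℝ,
      uniformPart (m / (2 * L)) (c - L) (c + L) (Set.Icc a b) ≤ ν (Set.Icc a b) := by
    intro a b
    -- The hypothesis covers only intervals in [0, ∞); as c - L ≥ 0, cutting at 0 loses nothing of
    -- the uniform part.
    set a' := max a 0 with ha'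
    have hsub : Set.Icc a b ∩ Set.Icc (c - L) (c + L)
        ⊆ Set.Icc a' b ∩ Set.Icc (c - L) (c + L) := by
      rintro x ⟨hx, hx'⟩
      exact ⟨⟨max_le hx.1 (by linarith [hx'.1]), hx.2⟩, hx'⟩
    rcases lt_or_ge b a' with hb | hb
    · rw [Set.Icc_eq_empty (not_le.2 hb), Set.empty_inter] at hsub
      simp [uniformPart, Measure.restrict_apply measurableSet_Icc, Set.subset_empty_iff.1 hsub]
    have h1 := h a' b (le_max_right _ _) hb
    have h2 : ∫ r in a'..b, (Set.Icc (c - L) (c + L)).indicator (fun _ => (1 : ℝ)) r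
        = volume.real (Set.Icc a' b ∩ Set.Icc (c - L) (c + L)) := by
      rw [intervalIntegral.integral_of_le hb, ← integral_Icc_eq_integral_Ioc,
        integral_indicator measurableSet_Icc, Measure.restrict_restrict measurableSet_Icc]
      simp [Set.inter_comm]
    rw [h2] at h1
    have hfin : volume (Set.Icc a' b ∩ Set.Icc (c - L) (c + L)) ≠ ⊤ :=
      ((measure_mono Set.inter_subset_left).trans_lt
        (by simp : volume (Set.Icc a' b) < ⊤)).ne
    calc uniformPart (m / (2 * L)) (c - L) (c + L) (Set.Icc a b)
        ≤ ENNReal.ofReal (m / (2 * L)) * volume (Set.Icc a' b ∩ Set.Icc (c - L) (c + L)) := by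
          simp only [uniformPart, Measure.smul_apply, smul_eq_mul,
            Measure.restrict_apply measurableSet_Icc]
          gcongr
      _ = ENNReal.ofReal (m / (2 * L)
            * volume.real (Set.Icc a' b ∩ Set.Icc (c - L) (c + L))) := by
          rw [ENNReal.ofReal_mul (by positivity), ofReal_measureReal hfin]
      _ ≤ ENNReal.ofReal (ν.real (Set.Icc a' b)) := ENNReal.ofReal_le_ofReal h1
      _ = ν (Set.Icc a' b) := ofReal_measureReal
      _ ≤ ν (Set.Icc a b) := measure_mono (Set.Icc_subset_Icc_left (le_max_left _ _))
  refine le_of_forall_Ioc fun a b => ?_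
  have hU : Set.Ioc a b = ⋃ n : ℕ, Set.Icc (a + 1 / ((n : ℝ) + 1)) b := by
    ext x
    simp only [Set.mem_Ioc, Set.mem_iUnion, Set.mem_Icc]
    constructor
    · rintro ⟨h1, h2⟩
      obtain ⟨n, hn⟩ := exists_nat_one_div_lt (sub_pos.2 h1)
      exact ⟨n, by linarith, h2⟩
    · rintro ⟨n, h1, h2⟩
      have : 0 < 1 / ((n : ℝ) + 1) := by positivity
      exact ⟨by linarith, h2⟩
  have hmono : Monotone fun n : ℕ => Set.Icc (a + 1 / ((n : ℝ) + 1)) b := by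
    intro n k hnk
    refine Set.Icc_subset_Icc_left ?_
    have : 1 / ((k : ℝ) + 1) ≤ 1 / ((n : ℝ) + 1) := by
      have : (n : ℝ) ≤ k := by exact_mod_cast hnk
      gcongr
    linarith
  rw [hU, hmono.measure_iUnion, hmono.measure_iUnion]
  exact iSup_mono fun n => hIcc _ _

/-! ### Exponential moments and Laplace transforms -/

/-- A measure that agrees with `ν` above the level `a` is, up to its mass, stochastically
dominated by the law `ν` conditioned to exceed `a`. -/
theorem lintegral_le_mul_lintegral_cond {ν r : Measure ℝ} [IsProbabilityMeasure ν] {a : ℝ}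
    (ha : ν (Set.Ioi a) ≠ 0) (hr : r.restrict (Set.Ioi a) = ν.restrict (Set.Ioi a))
    {g : ℝ → ENNReal} (hg : Monotone g) :
    ∫⁻ y, g y ∂r ≤ r Set.univ * ∫⁻ y, g y ∂(ν[|Set.Ioi a]) := by
  have hP : IsProbabilityMeasure (ν[|Set.Ioi a]) := cond_isProbabilityMeasure ha
  set I := ∫⁻ y, g y ∂(ν[|Set.Ioi a]) with hI
  have hrI : r (Set.Ioi a) = ν (Set.Ioi a) := by
    have := congrArg (fun m : Measure ℝ => m Set.univ) hr
    simpa using this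
  have h1 : ∫⁻ y in Set.Ioi a, g y ∂r = r (Set.Ioi a) * I := by
    rw [hr, hrI, hI, ProbabilityTheory.cond, lintegral_smul_measure, smul_eq_mul, ← mul_assoc,
      ENNReal.mul_inv_cancel ha (measure_ne_top _ _), one_mul]
  -- The conditioned law lives above `a`, so redistributing the mass of `r` below `a` according to
  -- it only increases the integral of a monotone function.
  have h2 : g a ≤ I := by
    calc g a = ∫⁻ _, g a ∂(ν[|Set.Ioi a]) := by simp
      _ ≤ I := by
        refine lintegral_mono_ae ?_
        have : ∀ᵐ y ∂(ν[|Set.Ioi a]), y ∈ Set.Ioi a := ae_cond_mem measurableSet_Ioi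
        filter_upwards [this] with y hy
        exact hg (le_of_lt hy)
  have h3 : ∫⁻ y in (Set.Ioi a)ᶜ, g y ∂r ≤ r (Set.Ioi a)ᶜ * I := by
    calc ∫⁻ y in (Set.Ioi a)ᶜ, g y ∂r ≤ ∫⁻ _ in (Set.Ioi a)ᶜ, I ∂r := by
          refine setLIntegral_mono' measurableSet_Ioi.compl fun y hy => ?_
          exact (hg (not_lt.1 hy)).trans h2
      _ = r (Set.Ioi a)ᶜ * I := by simp [mul_comm]
  calc ∫⁻ y, g y ∂r = ∫⁻ y in Set.Ioi a, g y ∂r + ∫⁻ y in (Set.Ioi a)ᶜ, g y ∂r :=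
        (lintegral_add_compl _ measurableSet_Ioi).symm
    _ ≤ r (Set.Ioi a) * I + r (Set.Ioi a)ᶜ * I := add_le_add h1.le h3
    _ = _ := by rw [← add_mul, measure_add_measure_compl measurableSet_Ioi]

/-- The integrand is monotone in each coordinate, so the stochastic domination can be applied to one
coordinate at a time. -/
theorem lintegral_exp_max_le {ν r₁ r₂ : Measure ℝ} [IsProbabilityMeasure ν] [SFinite r₁]
    [SFinite r₂] {a s : ℝ}
    (hs : 0 ≤ s) (ha : ν (Set.Ioi a) ≠ 0)
    (h₁ : r₁.restrict (Set.Ioi a) = ν.restrict (Set.Ioi a))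
    (h₂ : r₂.restrict (Set.Ioi a) = ν.restrict (Set.Ioi a)) :
    ∫⁻ q : ℝ × ℝ, ENNReal.ofReal (Real.exp (s * max q.1 q.2)) ∂(r₁.prod r₂)
      ≤ r₁ Set.univ * r₂ Set.univ * laplaceMax ν a s := by
  have hP : IsProbabilityMeasure (ν[|Set.Ioi a]) := cond_isProbabilityMeasure ha
  have hmeas : Measurable fun q : ℝ × ℝ => ENNReal.ofReal (Real.exp (s * max q.1 q.2)) := by
    fun_prop
  have hmono₂ : ∀ y : ℝ, Monotone fun z : ℝ => ENNReal.ofReal (Real.exp (s * max y z)) := by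
    intro y z z' h
    dsimp only
    gcongr
  have hmono₁ : Monotone fun y : ℝ =>
      ∫⁻ z, ENNReal.ofReal (Real.exp (s * max y z)) ∂(ν[|Set.Ioi a]) := by
    intro y y' h
    dsimp only
    gcongr
  unfold laplaceMax
  rw [lintegral_prod _ hmeas.aemeasurable, lintegral_prod _ hmeas.aemeasurable]
  calc ∫⁻ y, ∫⁻ z, ENNReal.ofReal (Real.exp (s * max y z)) ∂r₂ ∂r₁
      ≤ ∫⁻ y, r₂ Set.univ
          * ∫⁻ z, ENNReal.ofReal (Real.exp (s * max y z)) ∂(ν[|Set.Ioi a]) ∂r₁ :=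
        lintegral_mono fun y => lintegral_le_mul_lintegral_cond ha h₂ (hmono₂ y)
    _ = r₂ Set.univ * ∫⁻ y, ∫⁻ z, ENNReal.ofReal (Real.exp (s * max y z))
          ∂(ν[|Set.Ioi a]) ∂r₁ := lintegral_const_mul _ hmono₁.measurable
    _ ≤ r₂ Set.univ * (r₁ Set.univ * ∫⁻ y, ∫⁻ z, ENNReal.ofReal (Real.exp (s * max y z))
          ∂(ν[|Set.Ioi a]) ∂(ν[|Set.Ioi a])) := by
        gcongr
        exact lintegral_le_mul_lintegral_cond ha h₁ hmono₁
    _ = _ := by ring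

theorem laplace_neg_lt_one {ν : Measure ℝ} [IsProbabilityMeasure ν] (hν : ∀ᵐ y ∂ν, 0 < y)
    {b : ℝ} (hb : 0 < b) : laplace ν (-b) < 1 := by
  have hint : Integrable (fun y => Real.exp (-b * y)) ν := by
    refine Integrable.of_bound (by fun_prop) 1 ?_
    filter_upwards [hν] with y hy
    rw [Real.norm_eq_abs, Real.abs_exp, Real.exp_le_one_iff]
    nlinarith
  have h : 0 < ∫ y, (1 - Real.exp (-b * y)) ∂ν := by
    rw [integral_pos_iff_support_of_nonneg_ae]
    · have hs : ∀ᵐ y ∂ν, y ∈ Function.support fun y => 1 - Real.exp (-b * y) := by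
        filter_upwards [hν] with y hy
        have : Real.exp (-b * y) < 1 := Real.exp_lt_one_iff.2 (by nlinarith)
        simp only [Function.mem_support]
        linarith
      have : ν (Function.support fun y => 1 - Real.exp (-b * y)) = ν Set.univ :=
        measure_congr (Filter.eventuallyEq_univ.2 hs)
      rw [this]
      simp
    · filter_upwards [hν] with y hy
      have : Real.exp (-b * y) ≤ 1 := Real.exp_le_one_iff.2 (by nlinarith)
      simpa using this
    · exact (integrable_const 1).sub hint
  rw [integral_sub (integrable_const 1) hint] at h
  simp only [integral_const, probReal_univ, smul_eq_mul, mul_one, sub_pos] at h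
  exact h

theorem laplace_nonneg (ν : Measure ℝ) (b : ℝ) : 0 ≤ laplace ν b :=
  integral_nonneg fun _ => (Real.exp_pos _).le

/-! ### Renewal solutions, the weight and the coupling constants -/

/-- A measurable function `F : ℝ → [0, 1]` that solves the homogeneous renewal equation on
`[0, ∞)`. -/
structure IsRenewalSolution (ν : Measure ℝ) (F : ℝ → ℝ) : Prop where
  measurable : Measurable F
  nonneg : ∀ u, 0 ≤ F u
  le_one : ∀ u, F u ≤ 1
  eq_integral : ∀ u, 0 ≤ u → F u = ∫ y, F (u - y) ∂ν

namespace IsRenewalSolution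

variable {ν : Measure ℝ} {F : ℝ → ℝ}

theorem abs_sub_le_one (hF : IsRenewalSolution ν F) (a b : ℝ) : |F a - F b| ≤ 1 :=
  abs_sub_le_of_nonneg_of_le (hF.nonneg a) (hF.le_one a) (hF.nonneg b) (hF.le_one b)

theorem integrable (hF : IsRenewalSolution ν F) (r : Measure ℝ) [IsFiniteMeasure r] (a : ℝ) :
    Integrable (fun y => F (a - y)) r := by
  refine Integrable.of_bound
    (hF.measurable.comp (measurable_const.sub measurable_id)).aestronglyMeasurable 1 ?_
  refine Filter.Eventually.of_forall fun y => ?_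
  rw [Real.norm_eq_abs, abs_of_nonneg (hF.nonneg _)]
  exact hF.le_one _

end IsRenewalSolution

/-- The exponential weight that controls the oscillation of a renewal solution. -/
noncomputable def weight (s δ R a b : ℝ) : ℝ :=
  Real.exp (-(s * δ * max a b)) * if |a - b| ≤ R then 1 else Real.exp (s * |a - b|)

theorem weight_comm (s δ R a b : ℝ) : weight s δ R a b = weight s δ R b a := by
  simp only [weight, max_comm a b, abs_sub_comm a b]

theorem weight_le {s : ℝ} (hs : 0 ≤ s) (δ R a b : ℝ) :
    weight s δ R a b ≤ Real.exp (s * |a - b| - s * δ * max a b) := by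
  rw [sub_eq_neg_add, Real.exp_add, weight]
  gcongr
  split_ifs
  · exact Real.one_le_exp (by positivity)
  · exact le_rfl

theorem weight_nonneg (s δ R a b : ℝ) : 0 ≤ weight s δ R a b := by
  unfold weight
  split_ifs <;> positivity

theorem exp_le_weight {s : ℝ} (hs : 0 ≤ s) (δ R a b : ℝ) :
    Real.exp (-(s * δ * max a b)) ≤ weight s δ R a b := by
  unfold weight
  refine le_mul_of_one_le_right (Real.exp_pos _).le ?_
  split_ifs
  · exact le_rfl
  · exact Real.one_le_exp (by positivity)

/-- The constants of the coupling argument and the relations between them. -/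
structure CouplingData (ν : Measure ℝ) (m c L s δ R Λ C : ℝ) : Prop where
  pos : ∀ᵐ y ∂ν, 0 < y
  uniform : uniformPart (m / (2 * L)) (c - L) (c + L) ≤ ν
  m_pos : 0 < m
  m_lt : m < 1
  L_pos : 0 < L
  L_le : L ≤ c
  s_nonneg : 0 ≤ s
  δ_nonneg : 0 ≤ δ
  δ_le : δ ≤ 1
  R_pos : 0 < R
  tail : ν (Set.Ioi (c + L)) ≠ 0
  laplaceMax_eq : laplaceMax ν (c + L) s = ENNReal.ofReal Λ
  one_le_Λ : 1 ≤ Λ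
  exp_le : Real.exp (s * R) ≤ C
  -- This makes `C` reproduce itself over one cycle of matched jumps; p = (m / 2) ^ ⌈R / L⌉ is the
  -- weight of complete success.
  attempt_le : ((1 - (m / 2) ^ ⌈R / L⌉₊) * C + (m / 2) ^ ⌈R / L⌉₊)
    * (Real.exp (s * (R + (⌊R / L⌋₊ : ℝ) * c)) * Λ) ≤ C
  drift : ∀ d, R ≤ d → ∫⁻ y, ENNReal.ofReal (Real.exp (s * (|d - y| + δ * y))) ∂ν
    ≤ ENNReal.ofReal (Real.exp (s * d))

/-- The unmatched parts jump independently. Both have mass q, so integrating over the product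
measure yields q times the difference. The exponent grows by at most s times the larger jump: δ ≤ 1
lets one term absorb both the change of distance and the loss of remaining time. -/
theorem abs_integral_sub_le {r₁ r₂ ν : Measure ℝ} [IsFiniteMeasure r₁] [IsFiniteMeasure r₂]
    {F : ℝ → ℝ} (hF : IsRenewalSolution ν F) {q s δ Λ C κ a b : ℝ} (hq : 0 < q)
    (h₁ : r₁.real Set.univ = q) (h₂ : r₂.real Set.univ = q)
    (hp₁ : ∀ᵐ y ∂r₁, 0 < y) (hp₂ : ∀ᵐ y ∂r₂, 0 < y) (hs : 0 ≤ s) (hδ1 : δ ≤ 1)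
    (hΛ : 0 ≤ Λ) (hC : 0 ≤ C) (hκ : 0 ≤ κ)
    (hmax : ∫⁻ z : ℝ × ℝ, ENNReal.ofReal (Real.exp (s * max z.1 z.2)) ∂(r₁.prod r₂)
      ≤ ENNReal.ofReal (q * q * Λ))
    (hb : ∀ a b, |F a - F b|
      ≤ C * Real.exp (s * |a - b| - s * δ * max a b) + κ * (Real.exp a + Real.exp b))
    (hab : b ≤ a) :
    |∫ y, F (a - y) ∂r₁ - ∫ y, F (b - y) ∂r₂|
      ≤ q * (C * Real.exp (s * (a - b) - s * δ * a) * Λ + κ * (Real.exp a + Real.exp b)) := by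
  set I := ∫ z : ℝ × ℝ, Real.exp (s * max z.1 z.2) ∂(r₁.prod r₂) with hI
  have hIint : Integrable (fun z : ℝ × ℝ => Real.exp (s * max z.1 z.2)) (r₁.prod r₂) := by
    refine ⟨by fun_prop, ?_⟩
    rw [hasFiniteIntegral_iff_ofReal (Filter.Eventually.of_forall fun _ => (Real.exp_pos _).le)]
    exact hmax.trans_lt ENNReal.ofReal_lt_top
  have hIle : I ≤ q * q * Λ := by
    rw [hI, integral_eq_lintegral_of_nonneg_ae
      (Filter.Eventually.of_forall fun _ => (Real.exp_pos _).le) hIint.1]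
    exact ENNReal.toReal_le_of_le_ofReal (by positivity) hmax
  have e₁ : ∫ z : ℝ × ℝ, F (a - z.1) ∂(r₁.prod r₂) = q * ∫ y, F (a - y) ∂r₁ := by
    rw [integral_fun_fst (fun y => F (a - y)), h₂, smul_eq_mul]
  have e₂ : ∫ z : ℝ × ℝ, F (b - z.2) ∂(r₁.prod r₂) = q * ∫ y, F (b - y) ∂r₂ := by
    rw [integral_fun_snd (fun y => F (b - y)), h₁, smul_eq_mul]
  have i₁ : Integrable (fun z : ℝ × ℝ => F (a - z.1)) (r₁.prod r₂) :=
    (hF.integrable r₁ a).comp_fst r₂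
  have i₂ : Integrable (fun z : ℝ × ℝ => F (b - z.2)) (r₁.prod r₂) :=
    (hF.integrable r₂ b).comp_snd r₁
  have hpt : ∀ᵐ z ∂(r₁.prod r₂), ‖F (a - z.1) - F (b - z.2)‖
      ≤ C * Real.exp (s * (a - b) - s * δ * a) * Real.exp (s * max z.1 z.2)
        + κ * (Real.exp a + Real.exp b) := by
    have g₁ : ∀ᵐ z ∂(r₁.prod r₂), 0 < z.1 := Measure.quasiMeasurePreserving_fst.ae hp₁
    have g₂ : ∀ᵐ z ∂(r₁.prod r₂), 0 < z.2 := Measure.quasiMeasurePreserving_snd.ae hp₂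
    filter_upwards [g₁, g₂] with z hz₁ hz₂
    refine (hb _ _).trans ?_
    rw [mul_assoc C (Real.exp _) (Real.exp _), ← Real.exp_add]
    have hm₁ := le_max_left z.1 z.2
    have hm₂ := le_max_right z.1 z.2
    gcongr
    · have key : |a - z.1 - (b - z.2)| - δ * max (a - z.1) (b - z.2)
          ≤ (a - b) - δ * a + max z.1 z.2 := by
        rcases le_total (a - z.1) (b - z.2) with h | h
        · rw [max_eq_right h, abs_of_nonpos (by linarith)]
          nlinarith
        · rw [max_eq_left h, abs_of_nonneg (by linarith)]
          nlinarith
      nlinarith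
    · linarith
    · linarith
  have hint := norm_integral_le_of_norm_le
    ((hIint.const_mul (C * Real.exp (s * (a - b) - s * δ * a))).add
      (integrable_const (κ * (Real.exp a + Real.exp b)))) hpt
  simp only [Pi.add_apply] at hint
  rw [integral_sub i₁ i₂, e₁, e₂, integral_add (hIint.const_mul _) (integrable_const _),
    integral_const_mul, integral_const, ← hI, ← mul_sub, norm_mul, Real.norm_eq_abs,
    Real.norm_eq_abs, abs_of_pos hq, smul_eq_mul, measureReal_def, ← Set.univ_prod_univ,
    Measure.prod_prod, ENNReal.toReal_mul, ← measureReal_def, ← measureReal_def, h₁, h₂] at hint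
  refine le_of_mul_le_mul_left (hint.trans ?_) hq
  have : C * Real.exp (s * (a - b) - s * δ * a) * I
      ≤ C * Real.exp (s * (a - b) - s * δ * a) * (q * q * Λ) := by gcongr
  linarith

/-! ### Oscillation of renewal solutions: matched jumps, drift, contraction -/

namespace CouplingData

theorem one_le_C {ν : Measure ℝ} {m c L s δ R Λ C : ℝ} (S : CouplingData ν m c L s δ R Λ C) :
    1 ≤ C :=
  (Real.one_le_exp (mul_nonneg S.s_nonneg S.R_pos.le)).trans S.exp_le

variable {ν : Measure ℝ} [IsProbabilityMeasure ν] {m c L s δ R Λ C : ℝ}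

/-- One attempt of a coupled jump, with the shift `σ` between the two jumps. -/
theorem abs_sub_le_of_shift (S : CouplingData ν m c L s δ R Λ C) {F : ℝ → ℝ}
    (hF : IsRenewalSolution ν F) {κ : ℝ} (hκ : 0 ≤ κ)
    (hb : ∀ a b, |F a - F b|
      ≤ C * Real.exp (s * |a - b| - s * δ * max a b) + κ * (Real.exp a + Real.exp b))
    {a b σ B : ℝ} (h0 : 0 ≤ b) (hab : b ≤ a) (hσ0 : 0 ≤ σ) (hσL : σ ≤ L)
    (hB : ∀ z ∈ Set.Icc (c - L) c, |F (a - σ - z) - F (b - z)| ≤ B) :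
    |F a - F b| ≤ m / 2 * B + (1 - m / 2)
      * (C * Real.exp (s * (a - b) - s * δ * a) * Λ + κ * (Real.exp a + Real.exp b)) := by
  have hL := S.L_pos
  have hm := S.m_pos
  have hm1 := S.m_lt
  -- A piece of length L stays inside [c - L, c + L] under every shift σ ≤ L. This is why only half
  -- of the uniform mass, η = m / 2, is matched.
  set u := uniformPart (m / (2 * L)) (c - L) c with hu
  set uσ := uniformPart (m / (2 * L)) (c - L + σ) (c + σ) with huσ
  have hule : u ≤ ν := (uniformPart_mono (Set.Icc_subset_Icc_right (by linarith))).trans S.uniform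
  have huσle : uσ ≤ ν :=
    (uniformPart_mono (Set.Icc_subset_Icc (by linarith) (by linarith))).trans S.uniform
  have hη : m / (2 * L) * (c - (c - L)) = m / 2 := by field_simp; ring
  have hησ : m / (2 * L) * (c + σ - (c - L + σ)) = m / 2 := by field_simp; ring
  have humass : u.real Set.univ = m / 2 := by
    rw [measureReal_def, hu, uniformPart_apply_univ (by positivity), hη,
      ENNReal.toReal_ofReal (by positivity)]
  have huσmass : uσ.real Set.univ = m / 2 := by
    rw [measureReal_def, huσ, uniformPart_apply_univ (by positivity), hησ,
      ENNReal.toReal_ofReal (by positivity)]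
  -- Removing a piece that vanishes beyond c + L leaves a remainder that still agrees with `ν`
  -- there, as the domination by the conditioned law requires.
  have hres : ∀ w : Measure ℝ, IsFiniteMeasure w → w ≤ ν → w.real Set.univ = m / 2 →
      w (Set.Ioi (c + L)) = 0 →
      (ν - w) + w = ν ∧ (ν - w).real Set.univ = 1 - m / 2 ∧ (∀ᵐ y ∂(ν - w), 0 < y) ∧
        (ν - w).restrict (Set.Ioi (c + L)) = ν.restrict (Set.Ioi (c + L)) := by
    intro w _ hw hwm hw0
    have hadd : (ν - w) + w = ν := Measure.sub_add_cancel_of_le hw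
    refine ⟨hadd, ?_, ae_mono Measure.sub_le S.pos, ?_⟩
    · have : ν.real Set.univ = (ν - w).real Set.univ + w.real Set.univ := by
        conv_lhs => rw [← hadd]
        exact measureReal_add_apply
      rw [probReal_univ, hwm] at this
      linarith
    · conv_rhs => rw [← hadd]
      rw [Measure.restrict_add, Measure.restrict_eq_zero.2 hw0, add_zero]
  obtain ⟨ha₁, hr₁, hp₁, ht₁⟩ := hres uσ inferInstance huσle huσmass
    (uniformPart_Ioi (by linarith))
  obtain ⟨ha₂, hr₂, hp₂, ht₂⟩ := hres u inferInstance hule humass (uniformPart_Ioi (by linarith))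
  have hmax : ∫⁻ z : ℝ × ℝ, ENNReal.ofReal (Real.exp (s * max z.1 z.2))
      ∂((ν - uσ).prod (ν - u)) ≤ ENNReal.ofReal ((1 - m / 2) * (1 - m / 2) * Λ) := by
    refine (lintegral_exp_max_le S.s_nonneg S.tail ht₁ ht₂).trans (le_of_eq ?_)
    rw [S.laplaceMax_eq, ← ofReal_measureReal, ← ofReal_measureReal (s := Set.univ) (μ := ν - u),
      hr₁, hr₂, ← ENNReal.ofReal_mul (by linarith),
      ← ENNReal.ofReal_mul (mul_nonneg (by linarith) (by linarith))]
  have hC := S.one_le_C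
  have hΛ := S.one_le_Λ
  have hresid := abs_integral_sub_le hF (by linarith) hr₁ hr₂ hp₁ hp₂ S.s_nonneg
    S.δ_le (by linarith) (by linarith) hκ hmax hb hab
  have ea : F a = ∫ y, F (a - y) ∂(ν - uσ) + ∫ z, F (a - σ - z) ∂u := by
    rw [hF.eq_integral a (h0.trans hab)]
    conv_lhs => rw [← ha₁]
    rw [integral_add_measure (hF.integrable _ _) (hF.integrable _ _), huσ,
      integral_uniformPart_translate]
    simp only [hu, sub_sub, add_comm σ]
  have eb : F b = ∫ y, F (b - y) ∂(ν - u) + ∫ z, F (b - z) ∂u := by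
    rw [hF.eq_integral b h0]
    conv_lhs => rw [← ha₂]
    rw [integral_add_measure (hF.integrable _ _) (hF.integrable _ _)]
  have hunif : |∫ z, F (a - σ - z) ∂u - ∫ z, F (b - z) ∂u| ≤ m / 2 * B := by
    rw [← integral_sub (hF.integrable _ _) (hF.integrable _ _), ← Real.norm_eq_abs]
    have : ∀ᵐ z ∂u, ‖F (a - σ - z) - F (b - z)‖ ≤ B := by
      refine Measure.ae_smul_measure ?_ _
      filter_upwards [ae_restrict_mem measurableSet_Icc] with z hz
      exact hB z hz
    refine (norm_integral_le_of_norm_le_const this).trans (le_of_eq ?_)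
    rw [humass, mul_comm]
  calc |F a - F b| = |(∫ z, F (a - σ - z) ∂u - ∫ z, F (b - z) ∂u)
        + (∫ y, F (a - y) ∂(ν - uσ) - ∫ y, F (b - y) ∂(ν - u))| := by
        congr 1
        rw [ea, eb]
        ring
    _ ≤ _ := (abs_add_le _ _).trans (add_le_add hunif hresid)

/-- The bound after at most `j + 1` successive coupled jumps. -/
theorem abs_sub_le_of_attempts (S : CouplingData ν m c L s δ R Λ C) {F : ℝ → ℝ}
    (hF : IsRenewalSolution ν F) {κ : ℝ} (hκ : 0 ≤ κ)
    (hb : ∀ a b, |F a - F b|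
      ≤ C * Real.exp (s * |a - b| - s * δ * max a b) + κ * (Real.exp a + Real.exp b)) (j : ℕ) :
    ∀ a b, b ≤ a → a - b ≤ (j + 1) * L → |F a - F b|
      ≤ ((1 - (m / 2) ^ (j + 1)) * C + (m / 2) ^ (j + 1))
          * (Real.exp (s * (a - b + j * c) - s * δ * a) * Λ)
        + κ * (1 - (m / 2) ^ (j + 1)) * (Real.exp a + Real.exp b) := by
  have hη0 : 0 < m / 2 := by linarith [S.m_pos]
  have hη1 : m / 2 < 1 := by linarith [S.m_lt]
  have hC := S.one_le_C
  have hΛ := S.one_le_Λ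
  have hs := S.s_nonneg
  have hδ := S.δ_nonneg
  have hδ1 := S.δ_le
  have hc : 0 < c := S.L_pos.trans_le S.L_le
  have hpow : ∀ n : ℕ, 0 ≤ (m / 2) ^ n ∧ (m / 2) ^ n ≤ 1 := fun n =>
    ⟨by positivity, pow_le_one₀ hη0.le hη1.le⟩
  -- For b < 0 the renewal equation is not available, but then a - b ≥ δ a and the right-hand side
  -- is at least 1.
  have hneg : ∀ (j : ℕ) (a b : ℝ), b ≤ a → b < 0 → |F a - F b|
      ≤ ((1 - (m / 2) ^ (j + 1)) * C + (m / 2) ^ (j + 1))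
          * (Real.exp (s * (a - b + j * c) - s * δ * a) * Λ)
        + κ * (1 - (m / 2) ^ (j + 1)) * (Real.exp a + Real.exp b) := by
    intro j a b hab hb0
    obtain ⟨hp0, hp1⟩ := hpow (j + 1)
    refine (hF.abs_sub_le_one a b).trans ?_
    have h1 : 1 ≤ (1 - (m / 2) ^ (j + 1)) * C + (m / 2) ^ (j + 1) := by nlinarith
    have h2 : 1 ≤ Real.exp (s * (a - b + j * c) - s * δ * a) := by
      refine Real.one_le_exp ?_
      have : 0 ≤ (j : ℝ) * c := by positivity
      have h3 : 0 ≤ a - b + j * c - δ * a := by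
        rcases le_total 0 a with ha | ha <;> nlinarith
      nlinarith
    have h3 : 1 ≤ Real.exp (s * (a - b + j * c) - s * δ * a) * Λ := one_le_mul_of_one_le_of_one_le h2 hΛ
    have h4 := one_le_mul_of_one_le_of_one_le h1 h3
    have h5 : 0 ≤ κ * (1 - (m / 2) ^ (j + 1)) * (Real.exp a + Real.exp b) := by
      have := sub_nonneg.2 hp1
      positivity
    linarith
  induction j with
  | zero =>
    intro a b hab hd
    rcases lt_or_ge b 0 with hb0 | hb0
    · exact hneg 0 a b hab hb0
    -- The shift a - b makes the two arguments coincide, hence B = 0.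
    have h := S.abs_sub_le_of_shift hF hκ hb (σ := a - b) (B := 0) hb0 hab (by linarith)
      (by push_cast at hd; linarith) (fun z _ => by simp)
    refine h.trans ?_
    simp only [Nat.cast_zero, zero_mul, add_zero, zero_add, pow_one, mul_zero]
    have : 0 ≤ m / 2 * (Real.exp (s * (a - b) - s * δ * a) * Λ) := by positivity
    linarith
  | succ j ih =>
    intro a b hab hd
    rcases lt_or_ge b 0 with hb0 | hb0
    · exact hneg (j + 1) a b hab hb0
    obtain ⟨hp0, hp1⟩ := hpow (j + 1)
    have hcoef : 0 ≤ (1 - (m / 2) ^ (j + 1)) * C + (m / 2) ^ (j + 1) := by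
      have := sub_nonneg.2 hp1
      positivity
    have hcoef' : 0 ≤ κ * (1 - (m / 2) ^ (j + 1)) := mul_nonneg hκ (sub_nonneg.2 hp1)
    have hσd : min (a - b) L ≤ a - b := min_le_left _ _
    have hσ0 : 0 ≤ min (a - b) L := le_min (by linarith) S.L_pos.le
    have h := S.abs_sub_le_of_shift hF hκ hb (σ := min (a - b) L)
      (B := ((1 - (m / 2) ^ (j + 1)) * C + (m / 2) ^ (j + 1))
          * (Real.exp (s * (a - b + ((j + 1 : ℕ) : ℝ) * c) - s * δ * a) * Λ)
        + κ * (1 - (m / 2) ^ (j + 1)) * (Real.exp a + Real.exp b)) hb0 hab hσ0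
      (min_le_right _ _) (fun z hz => by
        have hz0 : 0 ≤ z := by linarith [hz.1, S.L_le]
        refine (ih (a - min (a - b) L - z) (b - z) (by linarith) ?_).trans ?_
        · push_cast at hd
          rcases le_total (a - b) L with h | h
          · rw [min_eq_left h]
            have := S.L_pos
            have : 0 ≤ ((j : ℝ) + 1) * L := by positivity
            linarith
          · rw [min_eq_right h]
            linarith
        · refine add_le_add (mul_le_mul_of_nonneg_left (mul_le_mul_of_nonneg_right
            (Real.exp_le_exp.2 ?_) (by linarith)) hcoef) (mul_le_mul_of_nonneg_left
            (add_le_add (Real.exp_le_exp.2 ?_) (Real.exp_le_exp.2 ?_)) hcoef')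
          · have hz1 := hz.2
            push_cast
            -- One matched jump costs at most a factor exp (s c): the common part of the jump is z ≤
            -- c, and the extra shift is paid by the shorter distance since δ ≤ 1.
            have : a - min (a - b) L - z - (b - z) + j * c - δ * (a - min (a - b) L - z)
                ≤ a - b + (j + 1) * c - δ * a := by nlinarith
            nlinarith
          · linarith
          · linarith)
    refine h.trans ?_
    have hexp : Real.exp (s * (a - b) - s * δ * a)
        ≤ Real.exp (s * (a - b + ((j + 1 : ℕ) : ℝ) * c) - s * δ * a) := by
      gcongr
      have : 0 ≤ ((j + 1 : ℕ) : ℝ) * c := by positivity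
      linarith
    set E := Real.exp (s * (a - b + ((j + 1 : ℕ) : ℝ) * c) - s * δ * a)
    have h1 : (1 - m / 2) * (C * Real.exp (s * (a - b) - s * δ * a) * Λ)
        ≤ (1 - m / 2) * (C * E * Λ) := by
      have := sub_nonneg.2 hη1.le
      gcongr
    have e : (m / 2) ^ (j + 1 + 1) = (m / 2) ^ (j + 1) * (m / 2) := pow_succ _ _
    rw [e]
    nlinarith

/-- The drift estimate: a jump of the process that lags behind. -/
theorem abs_sub_le_of_drift (S : CouplingData ν m c L s δ R Λ C) {F : ℝ → ℝ}
    (hF : IsRenewalSolution ν F) {κ : ℝ}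
    (hb : ∀ a b, |F a - F b|
      ≤ C * Real.exp (s * |a - b| - s * δ * max a b) + κ * (Real.exp a + Real.exp b))
    {a b : ℝ} (ha : 0 ≤ a) (hab : R ≤ a - b) :
    |F a - F b| ≤ C * Real.exp (s * (a - b) - s * δ * a)
      + κ * (Real.exp a * laplace ν (-1) + Real.exp b) := by
  have hC := S.one_le_C
  have hR := S.R_pos
  have hs := S.s_nonneg
  have hδ := S.δ_nonneg
  have hdr := S.drift (a - b) hab
  have hIint : Integrable (fun y => Real.exp (s * (|a - b - y| + δ * y))) ν := by
    refine ⟨by fun_prop, ?_⟩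
    rw [hasFiniteIntegral_iff_ofReal (Filter.Eventually.of_forall fun _ => (Real.exp_pos _).le)]
    exact hdr.trans_lt ENNReal.ofReal_lt_top
  have hIle : ∫ y, Real.exp (s * (|a - b - y| + δ * y)) ∂ν ≤ Real.exp (s * (a - b)) := by
    rw [integral_eq_lintegral_of_nonneg_ae
      (Filter.Eventually.of_forall fun _ => (Real.exp_pos _).le) hIint.1]
    exact ENNReal.toReal_le_of_le_ofReal (Real.exp_pos _).le hdr
  have hLint : Integrable (fun y => Real.exp (-1 * y)) ν := by
    refine Integrable.of_bound (by fun_prop) 1 ?_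
    filter_upwards [S.pos] with y hy
    rw [Real.norm_eq_abs, Real.abs_exp, Real.exp_le_one_iff]
    linarith
  have hpt : ∀ᵐ y ∂ν, ‖F (a - y) - F b‖
      ≤ C * Real.exp (-(s * δ * a)) * Real.exp (s * (|a - b - y| + δ * y))
        + (κ * Real.exp a * Real.exp (-1 * y) + κ * Real.exp b) := by
    filter_upwards [S.pos] with y hy
    refine (hb _ _).trans ?_
    have e1 : κ * (Real.exp (a - y) + Real.exp b)
        = κ * Real.exp a * Real.exp (-1 * y) + κ * Real.exp b := by
      rw [mul_assoc κ, ← Real.exp_add]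
      ring_nf
    rw [e1, mul_assoc C, ← Real.exp_add]
    gcongr
    have h1 : a - y - b = a - b - y := by ring
    rw [h1]
    have h2 : a - y ≤ max (a - y) b := le_max_left _ _
    have h3 : s * δ * (a - y) ≤ s * δ * max (a - y) b := by gcongr
    linarith
  have i1 := hIint.const_mul (C * Real.exp (-(s * δ * a)))
  have i2 := hLint.const_mul (κ * Real.exp a)
  have i3 : Integrable (fun y => κ * Real.exp a * Real.exp (-1 * y) + κ * Real.exp b) ν :=
    i2.add (integrable_const _)
  have hint := norm_integral_le_of_norm_le (i1.add i3) hpt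
  simp only [Pi.add_apply] at hint
  rw [integral_sub (hF.integrable _ _) (integrable_const _), ← hF.eq_integral a ha,
    integral_add i1 i3, integral_add i2 (integrable_const _),
    integral_const_mul, integral_const_mul] at hint
  simp only [integral_const, probReal_univ, one_smul, Real.norm_eq_abs] at hint
  refine hint.trans ?_
  have h4 : C * Real.exp (-(s * δ * a)) * ∫ y, Real.exp (s * (|a - b - y| + δ * y)) ∂ν
      ≤ C * Real.exp (-(s * δ * a)) * Real.exp (s * (a - b)) := by gcongr
  have h5 : C * Real.exp (-(s * δ * a)) * Real.exp (s * (a - b))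
      = C * Real.exp (s * (a - b) - s * δ * a) := by
    rw [mul_assoc, ← Real.exp_add]
    ring_nf
  have h6 : laplace ν (-1) = ∫ y, Real.exp (-1 * y) ∂ν := rfl
  rw [h6]
  linarith

/-- The error term of an a priori bound contracts. -/
theorem contraction (S : CouplingData ν m c L s δ R Λ C) {F : ℝ → ℝ}
    (hF : IsRenewalSolution ν F) {κ : ℝ} (hκ : 0 ≤ κ)
    (hb : ∀ a b, |F a - F b| ≤ C * weight s δ R a b + κ * (Real.exp a + Real.exp b)) (a b : ℝ) :
    |F a - F b| ≤ C * weight s δ R a b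
      + max ((1 + laplace ν (-1)) / 2) (1 - (m / 2) ^ ⌈R / L⌉₊) * κ
        * (Real.exp a + Real.exp b) := by
  wlog hab : b ≤ a generalizing a b
  · have := this b a (le_of_not_ge hab)
    rwa [abs_sub_comm, weight_comm, add_comm (Real.exp b)] at this
  have hC := S.one_le_C
  have hs := S.s_nonneg
  have hδ := S.δ_nonneg
  have hl := laplace_neg_lt_one S.pos one_pos
  have hl0 := laplace_nonneg ν (-1)
  set ρ := max ((1 + laplace ν (-1)) / 2) (1 - (m / 2) ^ ⌈R / L⌉₊) with hρ
  have hρ0 : 0 ≤ ρ := le_max_of_le_left (by linarith)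
  have hh : 0 ≤ κ * (Real.exp a + Real.exp b) := by positivity
  have hb' : ∀ a b, |F a - F b|
      ≤ C * Real.exp (s * |a - b| - s * δ * max a b) + κ * (Real.exp a + Real.exp b) := by
    intro a b
    refine (hb a b).trans ?_
    gcongr
    exact weight_le hs _ _ _ _
  rcases lt_or_ge a 0 with ha | ha
  · have h1 := exp_le_weight hs δ R a b
    rw [max_eq_left hab] at h1
    have h2 : 1 ≤ Real.exp (-(s * δ * a)) := Real.one_le_exp (by nlinarith [mul_nonneg hs hδ])
    have h3 : 1 ≤ C * weight s δ R a b := one_le_mul_of_one_le_of_one_le hC (h2.trans h1)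
    have h4 : 0 ≤ ρ * κ * (Real.exp a + Real.exp b) := by positivity
    linarith [hF.abs_sub_le_one a b]
  rcases lt_or_ge R (a - b) with hR | hR
  · have hw : weight s δ R a b = Real.exp (s * (a - b) - s * δ * a) := by
      rw [weight, max_eq_left hab, abs_of_nonneg (by linarith), if_neg (not_le.2 hR),
        ← Real.exp_add]
      ring_nf
    rw [hw]
    refine (S.abs_sub_le_of_drift hF hb' ha hR.le).trans ?_
    -- The jump multiplies the larger term exp a by `laplace ν (-1)` < 1 and keeps exp b, so the sum
    -- contracts at least by the average of that factor and 1.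
    have h1 : Real.exp b ≤ Real.exp a := Real.exp_le_exp.2 hab
    have h2 : Real.exp a * laplace ν (-1) + Real.exp b
        ≤ (1 + laplace ν (-1)) / 2 * (Real.exp a + Real.exp b) := by nlinarith
    have h3 : (1 + laplace ν (-1)) / 2 * (Real.exp a + Real.exp b)
        ≤ ρ * (Real.exp a + Real.exp b) := by
      gcongr
      exact le_max_left _ _
    have := mul_le_mul_of_nonneg_left (h2.trans h3) hκ
    linarith
  · have hRL : 0 < R / L := div_pos S.R_pos S.L_pos
    -- There are j + 1 = ⌈R / L⌉ rounds, and j ≤ ⌊R / L⌋ bounds the number of factors exp (s c) to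
    -- be paid.
    obtain ⟨j, hj⟩ := Nat.exists_eq_succ_of_ne_zero (Nat.ceil_pos.2 hRL).ne'
    have hj' : ⌈R / L⌉₊ = j + 1 := hj
    have hle : R ≤ (j + 1) * L := by
      have := Nat.le_ceil (R / L)
      rw [hj', div_le_iff₀ S.L_pos] at this
      push_cast at this
      exact this
    have hjf : (j : ℝ) ≤ (⌊R / L⌋₊ : ℝ) := by
      have : ⌈R / L⌉₊ ≤ ⌊R / L⌋₊ + 1 := Nat.ceil_le_floor_add_one _
      rw [hj'] at this
      exact_mod_cast Nat.le_of_succ_le_succ this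
    have hatt := S.abs_sub_le_of_attempts hF hκ hb' j a b hab (hR.trans hle)
    have hfix := S.attempt_le
    rw [hj'] at hfix hρ
    have hc : 0 < c := S.L_pos.trans_le S.L_le
    have hη0 : 0 < m / 2 := by linarith [S.m_pos]
    have hη1 : m / 2 < 1 := by linarith [S.m_lt]
    have hp1 : 0 ≤ 1 - (m / 2) ^ (j + 1) := sub_nonneg.2 (pow_le_one₀ hη0.le hη1.le)
    have hΛ := S.one_le_Λ
    have hw : weight s δ R a b = Real.exp (-(s * δ * a)) := by
      rw [weight, max_eq_left hab, abs_of_nonneg (by linarith), if_pos hR, mul_one]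
    rw [hw]
    -- Within distance R the weight has no factor in |a - b|, so the distance is replaced by R and
    -- charged to `attempt_le`.
    have h1 : Real.exp (s * (a - b + j * c) - s * δ * a)
        ≤ Real.exp (s * (R + (⌊R / L⌋₊ : ℝ) * c)) * Real.exp (-(s * δ * a)) := by
      rw [← Real.exp_add, ← sub_eq_add_neg]
      gcongr
    have h2 : ((1 - (m / 2) ^ (j + 1)) * C + (m / 2) ^ (j + 1))
          * (Real.exp (s * (a - b + j * c) - s * δ * a) * Λ)
        ≤ C * Real.exp (-(s * δ * a)) := by
      calc _ ≤ ((1 - (m / 2) ^ (j + 1)) * C + (m / 2) ^ (j + 1))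
          * (Real.exp (s * (R + (⌊R / L⌋₊ : ℝ) * c)) * Real.exp (-(s * δ * a)) * Λ) := by gcongr
        _ = ((1 - (m / 2) ^ (j + 1)) * C + (m / 2) ^ (j + 1))
          * (Real.exp (s * (R + (⌊R / L⌋₊ : ℝ) * c)) * Λ) * Real.exp (-(s * δ * a)) := by ring
        _ ≤ _ := by gcongr
    have h3 : κ * (1 - (m / 2) ^ (j + 1)) * (Real.exp a + Real.exp b)
        ≤ ρ * κ * (Real.exp a + Real.exp b) := by
      rw [mul_comm ρ]
      gcongr
      rw [hρ]
      exact le_max_right _ _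
    linarith

/-- The oscillation of a solution of the renewal equation decays exponentially. -/
theorem abs_sub_le_weight (S : CouplingData ν m c L s δ R Λ C) {F : ℝ → ℝ}
    (hF : IsRenewalSolution ν F) (a b : ℝ) : |F a - F b| ≤ C * weight s δ R a b := by
  have hC := S.one_le_C
  have hs := S.s_nonneg
  have hδ := S.δ_nonneg
  have hl := laplace_neg_lt_one S.pos one_pos
  have hl0 := laplace_nonneg ν (-1)
  set ρ := max ((1 + laplace ν (-1)) / 2) (1 - (m / 2) ^ ⌈R / L⌉₊) with hρ
  have hρ0 : 0 ≤ ρ := le_max_of_le_left (by linarith)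
  have hη0 : 0 < m / 2 := by linarith [S.m_pos]
  have hρ1 : ρ < 1 := max_lt (by linarith) (by linarith [pow_pos hη0 ⌈R / L⌉₊])
  have hiter : ∀ n : ℕ, ∀ a b, |F a - F b|
      ≤ C * weight s δ R a b + ρ ^ n * (Real.exp a + Real.exp b) := by
    intro n
    induction n with
    | zero =>
      intro a b
      have h1 := hF.abs_sub_le_one a b
      rw [pow_zero, one_mul]
      -- The iteration starts from |F a - F b| ≤ 1: either both times are negative and the weight is
      -- at least 1, or exp a + exp b ≥ 1.
      rcases lt_or_ge (max a b) 0 with h | h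
      · have h2 : 1 ≤ Real.exp (-(s * δ * max a b)) :=
          Real.one_le_exp (by nlinarith [mul_nonneg hs hδ])
        have h3 : 1 ≤ C * weight s δ R a b :=
          one_le_mul_of_one_le_of_one_le hC (h2.trans (exp_le_weight hs δ R a b))
        have : 0 < Real.exp a + Real.exp b := by positivity
        linarith
      · have h2 : 0 ≤ C * weight s δ R a b :=
          mul_nonneg (by linarith) (weight_nonneg _ _ _ _ _)
        have h3 : 1 ≤ Real.exp a + Real.exp b := by
          rcases le_max_iff.1 h with h | h
          · linarith [Real.one_le_exp h, Real.exp_pos b]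
          · linarith [Real.one_le_exp h, Real.exp_pos a]
        linarith
    | succ n ih =>
      intro a b
      have := S.contraction hF (pow_nonneg hρ0 n) ih a b
      rwa [← hρ, ← pow_succ'] at this
  have hlim : Filter.Tendsto
      (fun n : ℕ => C * weight s δ R a b + ρ ^ n * (Real.exp a + Real.exp b)) Filter.atTop
      (nhds (C * weight s δ R a b + 0 * (Real.exp a + Real.exp b))) :=
    ((tendsto_pow_atTop_nhds_zero_of_lt_one hρ0 hρ1).mul_const _).const_add _
  rw [zero_mul, add_zero] at hlim
  exact ge_of_tendsto' hlim fun n => hiter n a b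

theorem abs_sub_le_exp (S : CouplingData ν m c L s δ R Λ C) {F : ℝ → ℝ}
    (hF : IsRenewalSolution ν F) {x : ℝ} (hx : 0 ≤ x) (t : ℝ) :
    |F (t - x) - F t| ≤ Real.exp (s * x) * C * Real.exp (-(s * δ * t)) := by
  have hC := S.one_le_C
  have h := (S.abs_sub_le_weight hF t (t - x)).trans
    (mul_le_mul_of_nonneg_left (weight_le S.s_nonneg δ R t (t - x)) (by linarith))
  rw [max_eq_left (by linarith), sub_sub_cancel, abs_of_nonneg hx, sub_eq_add_neg (s * x),
    Real.exp_add] at h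
  rw [abs_sub_comm]
  linarith

end CouplingData

/-! ### Sequence space and decomposition at the first jump -/

/-- The sequence with first entry `y`, followed by the sequence `ω`. -/
def consSeq (y : ℝ) (ω : ℕ → ℝ) : ℕ → ℝ
  | 0 => y
  | n + 1 => ω n

/-- The coordinates of sequence space. -/
def coord (i : ℕ) (ω : ℕ → ℝ) : ℝ := ω i

/-- The law of an i.i.d. sequence with marginal law `ν`. -/
noncomputable abbrev seqLaw (ν : Measure ℝ) : Measure (ℕ → ℝ) := Measure.infinitePi fun _ => ν

theorem measurable_consSeq : Measurable fun q : ℝ × (ℕ → ℝ) => consSeq q.1 q.2 := by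
  refine measurable_pi_iff.2 fun n => ?_
  cases n with
  | zero => exact measurable_fst
  | succ n => exact (measurable_pi_apply n).comp measurable_snd

/-- The product law is determined by finite-dimensional boxes, and the preimage of such a box splits
into a condition on the first entry and a box for the rest. -/
theorem seqLaw_eq_map (ν : Measure ℝ) [IsProbabilityMeasure ν] :
    seqLaw ν = (ν.prod (seqLaw ν)).map fun q => consSeq q.1 q.2 := by
  classical
  refine (Measure.eq_infinitePi _ fun s t ht => ?_).symm
  obtain ⟨N, hN⟩ := s.exists_nat_subset_range
  set t' : ℕ → Set ℝ := fun i => if i ∈ s then t i else Set.univ with ht'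
  have ht'm : ∀ i, MeasurableSet (t' i) := fun i => by
    simp only [ht']
    split_ifs
    exacts [ht i, MeasurableSet.univ]
  have hpre : (fun q : ℝ × (ℕ → ℝ) => consSeq q.1 q.2) ⁻¹' (Set.pi s t)
      = t' 0 ×ˢ Set.pi (Finset.range N) fun i => t' (i + 1) := by
    ext ⟨y, ω⟩
    simp only [Set.mem_preimage, Set.mem_pi, Set.mem_prod, ht']
    constructor
    · intro h
      refine ⟨?_, fun i _ => ?_⟩
      · split_ifs with h0
        exacts [h 0 h0, trivial]
      · split_ifs with h0
        exacts [h (i + 1) h0, trivial]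
    · rintro ⟨h1, h2⟩ i hi
      cases i with
      | zero =>
        rw [if_pos (Finset.mem_coe.1 hi)] at h1
        exact h1
      | succ i =>
        have hiN : i ∈ (Finset.range N : Set ℕ) := by
          have := Finset.mem_range.1 (hN hi)
          simp only [Finset.coe_range, Set.mem_Iio]
          omega
        have := h2 i hiN
        rwa [if_pos (Finset.mem_coe.1 hi)] at this
  rw [Measure.map_apply measurable_consSeq
    (MeasurableSet.pi (Finset.countable_toSet s) fun i _ => ht i), hpre, Measure.prod_prod,
    Measure.infinitePi_pi _ fun i _ => ht'm (i + 1), mul_comm,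
    ← Finset.prod_range_succ' fun i => ν (t' i)]
  have hsub : s ⊆ Finset.range (N + 1) :=
    hN.trans (Finset.range_subset_range.2 (Nat.le_succ N))
  rw [← Finset.prod_subset hsub fun i _ hi => by simp [ht', hi]]
  exact Finset.prod_congr rfl fun i hi => by simp [ht', hi]

theorem seqLaw_apply (ν : Measure ℝ) [IsProbabilityMeasure ν] {E : Set (ℕ → ℝ)}
    (hE : MeasurableSet E) : seqLaw ν E = ∫⁻ y, seqLaw ν {ω | consSeq y ω ∈ E} ∂ν := by
  conv_lhs => rw [seqLaw_eq_map]
  rw [Measure.map_apply measurable_consSeq hE, Measure.prod_apply (measurable_consSeq hE)]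
  rfl

theorem epoch_eq_add {Ω : Type*} (X : ℕ → Ω → ℝ) (x : ℝ) (n : ℕ) (ω : Ω) :
    epoch X x n ω = x + epoch X 0 n ω := by
  simp [epoch]

theorem epoch_zero {Ω : Type*} (X : ℕ → Ω → ℝ) (x : ℝ) (ω : Ω) : epoch X x 0 ω = x := by
  simp [epoch]

theorem epoch_consSeq (y : ℝ) (n : ℕ) (ω : ℕ → ℝ) :
    epoch coord 0 (n + 1) (consSeq y ω) = y + epoch coord 0 n ω := by
  simp [epoch, Finset.sum_range_succ', coord, consSeq, add_comm]

theorem epoch_coord {Ω : Type*} (X : ℕ → Ω → ℝ) (x : ℝ) (n : ℕ) (ω : Ω) :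
    epoch coord x n (fun i => X i ω) = epoch X x n ω := rfl

theorem residualLife_coord {Ω : Type*} (X : ℕ → Ω → ℝ) (x t : ℝ) (ω : Ω) :
    residualLife coord x t (fun i => X i ω) = residualLife X x t ω := by
  simp only [residualLife, nextIndex, epoch_coord]

theorem measurable_epoch (x : ℝ) (n : ℕ) : Measurable (epoch coord x n) := by
  unfold epoch coord
  fun_prop

/-- Every delay is reduced to the undelayed process, at the price of negative times when t < x. -/
theorem residualLife_eq_sub {Ω : Type*} (X : ℕ → Ω → ℝ) (x t : ℝ) (ω : Ω) :
    residualLife X x t ω = residualLife X 0 (t - x) ω := by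
  have h : nextIndex X x t ω = nextIndex X 0 (t - x) ω := by
    unfold nextIndex
    congr 1
    ext n
    simp only [Set.mem_ofPred_eq]
    rw [epoch_eq_add X x, sub_lt_iff_lt_add']
  unfold residualLife
  rw [h, epoch_eq_add X x]
  ring

theorem measurable_sInf_nat {α : Type*} [MeasurableSpace α] {S : ℕ → Set α}
    (hS : ∀ n, MeasurableSet (S n)) : Measurable fun a => sInf {n : ℕ | a ∈ S n} := by
  refine measurable_to_countable' fun n => ?_
  -- The second set accounts for the default value `sInf ∅ = 0`.
  have : (fun a => sInf {n : ℕ | a ∈ S n}) ⁻¹' {n}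
      = (S n ∩ ⋂ k, ⋂ _ : k < n, (S k)ᶜ) ∪ ({_a : α | n = 0} ∩ ⋂ k, (S k)ᶜ) := by
    ext a
    simp only [Set.mem_preimage, Set.mem_singleton_iff, Set.mem_union, Set.mem_inter_iff,
      Set.mem_iInter, Set.mem_compl_iff, Set.mem_ofPred_eq]
    constructor
    · rintro rfl
      rcases Set.eq_empty_or_nonempty {n : ℕ | a ∈ S n} with h | h
      · right
        refine ⟨by rw [h, Nat.sInf_empty], fun k hk => ?_⟩
        have : k ∈ {n : ℕ | a ∈ S n} := hk
        rw [h] at this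
        exact this
      · exact Or.inl ⟨Nat.sInf_mem h, fun k hk => Nat.notMem_of_lt_sInf hk⟩
    · rintro (⟨h1, h2⟩ | ⟨rfl, h⟩)
      · refine le_antisymm (Nat.sInf_le h1) ?_
        by_contra hlt
        exact h2 _ (not_le.1 hlt) (Nat.sInf_mem (s := {n : ℕ | a ∈ S n}) ⟨n, h1⟩)
      · have : {n : ℕ | a ∈ S n} = ∅ := Set.eq_empty_of_forall_notMem h
        rw [this, Nat.sInf_empty]
  rw [this]
  refine ((hS n).inter ?_).union ((MeasurableSet.const _).inter ?_)
  · exact MeasurableSet.iInter fun k => MeasurableSet.iInter fun _ => (hS k).compl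
  · exact MeasurableSet.iInter fun k => (hS k).compl

theorem measurable_residualLife :
    Measurable fun q : ℝ × (ℕ → ℝ) => residualLife coord 0 q.1 q.2 := by
  have h1 : Measurable fun q : ℝ × (ℕ → ℝ) => nextIndex coord 0 q.1 q.2 :=
    measurable_sInf_nat (S := fun n => {q : ℝ × (ℕ → ℝ) | q.1 < epoch coord 0 n q.2})
      fun n => measurableSet_lt measurable_fst ((measurable_epoch 0 n).comp measurable_snd)
  have h2 : Measurable fun q : ℕ × (ℕ → ℝ) => epoch coord 0 q.1 q.2 :=
    measurable_from_prod_countable_right fun n => measurable_epoch 0 n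
  exact (h2.comp (h1.prodMk measurable_snd)).sub measurable_fst

theorem measurable_residualLife_right (u : ℝ) : Measurable (residualLife coord 0 u) := by
  have h := measurable_residualLife.comp (measurable_prodMk_left (x := u))
  rwa [Function.comp_def] at h

/-- For u ≥ 0 the epoch at 0 is not after u, so the next index is at least 1 and the first jump
splits off. The hypothesis `h` excludes the default value of `sInf`. -/
theorem residualLife_consSeq {u y : ℝ} (hu : 0 ≤ u) {ω : ℕ → ℝ}
    (h : ∃ n, u - y < epoch coord 0 n ω) :
    residualLife coord 0 u (consSeq y ω) = residualLife coord 0 (u - y) ω := by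
  have hne : {n : ℕ | u < epoch coord 0 n (consSeq y ω)}.Nonempty := by
    obtain ⟨n, hn⟩ := h
    refine ⟨n + 1, ?_⟩
    rw [Set.mem_ofPred_eq, epoch_consSeq]
    linarith
  have h1 : 1 ≤ sInf {n : ℕ | u < epoch coord 0 n (consSeq y ω)} := by
    refine Nat.one_le_iff_ne_zero.2 fun h0 => ?_
    have := Nat.sInf_mem hne
    rw [h0, Set.mem_ofPred_eq, epoch_zero] at this
    linarith
  have h2 : nextIndex coord 0 u (consSeq y ω) = nextIndex coord 0 (u - y) ω + 1 := by
    have := Nat.sInf_add h1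
    unfold nextIndex
    rw [← this]
    congr 2
    ext n
    simp only [Set.mem_ofPred_eq]
    rw [epoch_consSeq, sub_lt_iff_lt_add']
  unfold residualLife
  rw [h2, epoch_consSeq]
  ring

/-! ### Expected counts and renewal equations -/

/-- The expected number of epochs of the undelayed renewal process in `u + D`. -/
noncomputable def expectedCount (ν : Measure ℝ) (D : Set ℝ) (u : ℝ) : ENNReal :=
  ∑' n, seqLaw ν {ω | epoch coord 0 n ω - u ∈ D}

theorem expectedCount_mono (ν : Measure ℝ) {D D' : Set ℝ} (h : D ⊆ D') (u : ℝ) :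
    expectedCount ν D u ≤ expectedCount ν D' u :=
  ENNReal.tsum_le_tsum fun _ => measure_mono fun _ hω => h hω

section

variable {ν : Measure ℝ} [IsProbabilityMeasure ν]

theorem lintegral_exp_neg (hν : ∀ᵐ y ∂ν, 0 < y) :
    ∫⁻ y, ENNReal.ofReal (Real.exp (-1 * y)) ∂ν = ENNReal.ofReal (laplace ν (-1)) := by
  refine (ofReal_integral_eq_lintegral_ofReal ?_
    (Filter.Eventually.of_forall fun _ => (Real.exp_pos _).le)).symm
  refine Integrable.of_bound (by fun_prop) 1 ?_
  filter_upwards [hν] with y hy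
  rw [Real.norm_eq_abs, Real.abs_exp, Real.exp_le_one_iff]
  linarith

/-- Chernoff's bound for the epochs. -/
theorem seqLaw_epoch_le (hν : ∀ᵐ y ∂ν, 0 < y) (n : ℕ) (v : ℝ) :
    seqLaw ν {ω | epoch coord 0 n ω ≤ v}
      ≤ ENNReal.ofReal (Real.exp v) * ENNReal.ofReal (laplace ν (-1)) ^ n := by
  induction n generalizing v with
  | zero =>
    simp only [epoch_zero, pow_zero, mul_one]
    by_cases hv : 0 ≤ v
    · refine prob_le_one.trans ?_
      rw [← ENNReal.ofReal_one]
      exact ENNReal.ofReal_le_ofReal (Real.one_le_exp hv)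
    · simp [hv]
  | succ n ih =>
    rw [seqLaw_apply ν (measurableSet_le (measurable_epoch 0 (n + 1)) measurable_const)]
    simp only [Set.mem_ofPred_eq, epoch_consSeq]
    calc ∫⁻ y, seqLaw ν {ω | y + epoch coord 0 n ω ≤ v} ∂ν
        ≤ ∫⁻ y, ENNReal.ofReal (Real.exp v) * ENNReal.ofReal (laplace ν (-1)) ^ n
            * ENNReal.ofReal (Real.exp (-1 * y)) ∂ν := by
          refine lintegral_mono fun y => ?_
          have h1 : {ω : ℕ → ℝ | y + epoch coord 0 n ω ≤ v} = {ω | epoch coord 0 n ω ≤ v - y} := by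
            ext ω
            simp only [Set.mem_ofPred_eq]
            constructor <;> intro h <;> linarith
          dsimp only
          rw [h1]
          refine (ih (v - y)).trans (le_of_eq ?_)
          rw [mul_right_comm, ← ENNReal.ofReal_mul (Real.exp_pos _).le, ← Real.exp_add]
          ring_nf
      _ = _ := by
          rw [lintegral_const_mul _ (by fun_prop), lintegral_exp_neg hν, mul_assoc, ← pow_succ]

theorem ofReal_laplace_lt_one (hν : ∀ᵐ y ∂ν, 0 < y) : ENNReal.ofReal (laplace ν (-1)) < 1 := by
  rw [ENNReal.ofReal_lt_one]
  exact laplace_neg_lt_one hν one_pos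

theorem ae_exists_lt_epoch (hν : ∀ᵐ y ∂ν, 0 < y) (v : ℝ) :
    ∀ᵐ ω ∂(seqLaw ν), ∃ n, v < epoch coord 0 n ω := by
  rw [ae_iff]
  have h : ∀ n : ℕ, seqLaw ν {ω | ¬∃ n, v < epoch coord 0 n ω}
      ≤ ENNReal.ofReal (Real.exp v) * ENNReal.ofReal (laplace ν (-1)) ^ n := fun n =>
    (measure_mono fun ω (hω : ¬∃ n, v < epoch coord 0 n ω) =>
      not_lt.1 fun hn => hω ⟨n, hn⟩).trans (seqLaw_epoch_le hν n v)
  have hlim := ENNReal.Tendsto.const_mul (a := ENNReal.ofReal (Real.exp v))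
    (ENNReal.tendsto_pow_atTop_nhds_zero_of_lt_one (ofReal_laplace_lt_one hν))
    (Or.inr ENNReal.ofReal_ne_top)
  rw [mul_zero] at hlim
  exact le_antisymm (ge_of_tendsto' hlim h) zero_le

theorem isRenewalSolution_residualLife (hν : ∀ᵐ y ∂ν, 0 < y) {A : Set ℝ} (hA : MeasurableSet A) :
    IsRenewalSolution ν fun u => (seqLaw ν).real {ω | residualLife coord 0 u ω ∈ A} := by
  have hmeas : Measurable fun u => seqLaw ν {ω | residualLife coord 0 u ω ∈ A} :=
    measurable_measure_prodMk_left (measurable_residualLife hA)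
  refine ⟨hmeas.ennreal_toReal, fun u => measureReal_nonneg, fun u => measureReal_le_one,
    fun u hu => ?_⟩
  simp only [measureReal_def]
  have hmeas' : Measurable fun y => seqLaw ν {ω | residualLife coord 0 (u - y) ω ∈ A} :=
    hmeas.comp (measurable_const.sub measurable_id)
  rw [integral_toReal hmeas'.aemeasurable
    (Filter.Eventually.of_forall fun y => measure_lt_top _ _)]
  congr 1
  have hE : MeasurableSet {ω | residualLife coord 0 u ω ∈ A} :=
    measurable_residualLife_right u hA
  rw [seqLaw_apply ν hE]
  refine lintegral_congr fun y => measure_congr ?_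
  filter_upwards [ae_exists_lt_epoch hν (u - y)] with ω hω
  refine propext ?_
  change residualLife coord 0 u (consSeq y ω) ∈ A ↔ residualLife coord 0 (u - y) ω ∈ A
  rw [residualLife_consSeq hu hω]

theorem measurable_expectedCount {D : Set ℝ} (hD : MeasurableSet D) :
    Measurable (expectedCount ν D) := by
  unfold expectedCount
  refine Measurable.tsum fun n => ?_
  have h : Measurable fun q : ℝ × (ℕ → ℝ) => epoch coord 0 n q.2 - q.1 :=
    ((measurable_epoch 0 n).comp measurable_snd).sub measurable_fst
  exact measurable_measure_prodMk_left (h hD)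

theorem expectedCount_le (hν : ∀ᵐ y ∂ν, 0 < y) {D : Set ℝ} {M : ℝ} (hD : D ⊆ Set.Iic M) (u : ℝ) :
    expectedCount ν D u
      ≤ ENNReal.ofReal (Real.exp M) * (1 - ENNReal.ofReal (laplace ν (-1)))⁻¹
        * ENNReal.ofReal (Real.exp u) := by
  calc expectedCount ν D u
      ≤ ∑' n : ℕ, ENNReal.ofReal (Real.exp (u + M)) * ENNReal.ofReal (laplace ν (-1)) ^ n := by
        refine ENNReal.tsum_le_tsum fun n => ?_
        refine (measure_mono fun ω hω => ?_).trans (seqLaw_epoch_le hν n (u + M))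
        have : epoch coord 0 n ω - u ≤ M := hD hω
        simp only [Set.mem_ofPred_eq]
        linarith
    _ = _ := by
        rw [ENNReal.tsum_mul_left, ENNReal.tsum_geometric, Real.exp_add,
          ENNReal.ofReal_mul (Real.exp_pos _).le]
        ring

theorem expectedCount_lt_top (hν : ∀ᵐ y ∂ν, 0 < y) {D : Set ℝ} (hD : BddAbove D) (u : ℝ) :
    expectedCount ν D u < ⊤ := by
  obtain ⟨M, hM⟩ := hD
  refine (expectedCount_le hν (fun x hx => hM hx) u).trans_lt ?_
  refine ENNReal.mul_lt_top (ENNReal.mul_lt_top ENNReal.ofReal_lt_top ?_) ENNReal.ofReal_lt_top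
  rw [ENNReal.inv_lt_top]
  exact tsub_pos_of_lt (ofReal_laplace_lt_one hν)

/-- For u ≥ 0 the epoch T_0 = 0 misses u + D ⊂ (0, ∞), so the sum starts at n = 1 and the first jump
can be split off. -/
theorem expectedCount_eq_lintegral {D : Set ℝ} (hD : MeasurableSet D) (hD0 : D ⊆ Set.Ioi 0)
    {u : ℝ} (hu : 0 ≤ u) : expectedCount ν D u = ∫⁻ y, expectedCount ν D (u - y) ∂ν := by
  have hm : ∀ n, Measurable fun y => seqLaw ν {ω | epoch coord 0 n ω - (u - y) ∈ D} := by
    intro n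
    have h : Measurable fun q : ℝ × (ℕ → ℝ) => epoch coord 0 n q.2 - (u - q.1) :=
      ((measurable_epoch 0 n).comp measurable_snd).sub (measurable_const.sub measurable_fst)
    exact measurable_measure_prodMk_left (h hD)
  unfold expectedCount
  rw [lintegral_tsum fun n => (hm n).aemeasurable, tsum_eq_zero_add' ENNReal.summable]
  have h0 : seqLaw ν {ω | epoch coord 0 0 ω - u ∈ D} = 0 := by
    have : {ω : ℕ → ℝ | epoch coord 0 0 ω - u ∈ D} = ∅ := by
      refine Set.eq_empty_of_forall_notMem fun ω hω => ?_
      have : 0 < epoch coord 0 0 ω - u := hD0 hω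
      rw [epoch_zero] at this
      linarith
    rw [this, measure_empty]
  rw [h0, zero_add]
  refine tsum_congr fun n => ?_
  have hE : MeasurableSet {ω | epoch coord 0 (n + 1) ω - u ∈ D} :=
    ((measurable_epoch 0 (n + 1)).sub_const u) hD
  rw [seqLaw_apply ν hE]
  refine lintegral_congr fun y => ?_
  congr 1
  ext ω
  change epoch coord 0 (n + 1) (consSeq y ω) - u ∈ D ↔ epoch coord 0 n ω - (u - y) ∈ D
  rw [epoch_consSeq, show y + epoch coord 0 n ω - u = epoch coord 0 n ω - (u - y) by ring]

theorem ae_epoch_pos (hν : ∀ᵐ y ∂ν, 0 < y) (n : ℕ) :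
    ∀ᵐ ω ∂(seqLaw ν), 0 < epoch coord 0 (n + 1) ω := by
  have h : ∀ᵐ ω ∂(seqLaw ν), ∀ i, 0 < ω i := by
    refine ae_all_iff.2 fun i => ?_
    exact (measurePreserving_eval_infinitePi (fun _ => ν) i).quasiMeasurePreserving.ae hν
  filter_upwards [h] with ω hω
  simp only [epoch, zero_add, coord]
  exact Finset.sum_pos (fun i _ => hω i) (by simp)

/-- For u < 0 a positive epoch T in u + D satisfies T < T - u ≤ sup D; the epoch T_0 accounts for
the additional 1. -/
theorem expectedCount_le_of_neg (hν : ∀ᵐ y ∂ν, 0 < y) {D : Set ℝ} {u : ℝ} (hu : u < 0) :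
    expectedCount ν D u ≤ expectedCount ν (intervalToSup D) 0 + 1 := by
  unfold expectedCount
  rw [tsum_eq_zero_add' ENNReal.summable, add_comm]
  refine add_le_add ?_ prob_le_one
  conv_rhs => rw [tsum_eq_zero_add' ENNReal.summable]
  refine le_add_left (ENNReal.tsum_le_tsum fun n => measure_mono_ae ?_)
  filter_upwards [ae_epoch_pos hν n] with ω hpos
  intro hω
  change epoch coord 0 (n + 1) ω - 0 ∈ intervalToSup D
  change epoch coord 0 (n + 1) ω - u ∈ D at hω
  rw [sub_zero]
  refine ⟨hpos, lt_of_lt_of_le ?_ (le_biSup (fun d : ℝ => (d : EReal)) hω)⟩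
  exact EReal.coe_lt_coe (by linarith)

/-- The maximum principle for the renewal equation, applied to the expected count. -/
theorem expectedCount_le_add_one (hν : ∀ᵐ y ∂ν, 0 < y) {D : Set ℝ} (hD : MeasurableSet D)
    (hD0 : D ⊆ Set.Ioi 0) (hDb : BddAbove D) (u : ℝ) :
    expectedCount ν D u ≤ expectedCount ν (intervalToSup D) 0 + 1 := by
  obtain ⟨M, hM⟩ := hDb
  set G := expectedCount ν (intervalToSup D) 0 + 1
  set κ := ENNReal.ofReal (Real.exp M) * (1 - ENNReal.ofReal (laplace ν (-1)))⁻¹ with hκ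
  have hκt : κ ≠ ⊤ := by
    refine ENNReal.mul_ne_top ENNReal.ofReal_ne_top ?_
    rw [ENNReal.inv_ne_top]
    exact (tsub_pos_of_lt (ofReal_laplace_lt_one hν)).ne'
  -- The a priori growth exp u is an error term that each use of the equation multiplies by `laplace
  -- ν (-1)` < 1; negative times need no error term.
  have hiter : ∀ n : ℕ, ∀ u, expectedCount ν D u
      ≤ G + κ * ENNReal.ofReal (Real.exp u) * ENNReal.ofReal (laplace ν (-1)) ^ n := by
    intro n
    induction n with
    | zero =>
      intro u
      rw [pow_zero, mul_one]
      exact le_add_left (expectedCount_le hν (fun x hx => hM hx) u)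
    | succ n ih =>
      intro u
      rcases lt_or_ge u 0 with hu | hu
      · exact le_add_right (expectedCount_le_of_neg hν hu)
      rw [expectedCount_eq_lintegral hD hD0 hu]
      calc ∫⁻ y, expectedCount ν D (u - y) ∂ν
          ≤ ∫⁻ y, (G + κ * ENNReal.ofReal (Real.exp u) * ENNReal.ofReal (laplace ν (-1)) ^ n
              * ENNReal.ofReal (Real.exp (-1 * y))) ∂ν := by
            refine lintegral_mono fun y => (ih (u - y)).trans (le_of_eq ?_)
            rw [show u - y = u + -1 * y by ring, Real.exp_add,
              ENNReal.ofReal_mul (Real.exp_pos _).le]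
            ring
        _ = _ := by
            rw [lintegral_add_left measurable_const, lintegral_const, measure_univ, mul_one,
              lintegral_const_mul _ (by fun_prop), lintegral_exp_neg hν, mul_assoc, ← pow_succ]
  have hlim := ENNReal.Tendsto.const_mul (a := κ * ENNReal.ofReal (Real.exp u))
    (ENNReal.tendsto_pow_atTop_nhds_zero_of_lt_one (ofReal_laplace_lt_one hν))
    (Or.inr (ENNReal.mul_ne_top hκt ENNReal.ofReal_ne_top))
  rw [mul_zero] at hlim
  have hlim' := hlim.const_add G
  rw [add_zero] at hlim'
  exact ge_of_tendsto' hlim' fun n => hiter n u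

theorem intervalToSup_mono {D D' : Set ℝ} (h : D ⊆ D') : intervalToSup D ⊆ intervalToSup D' :=
  fun _ hs => ⟨hs.1, hs.2.trans_le (biSup_mono h)⟩

theorem bddAbove_intervalToSup {D : Set ℝ} (h : BddAbove D) : BddAbove (intervalToSup D) := by
  obtain ⟨M, hM⟩ := h
  refine ⟨M, fun s hs => ?_⟩
  have h1 : (s : EReal) < M := hs.2.trans_le (iSup₂_le fun d hd => EReal.coe_le_coe (hM hd))
  exact (EReal.coe_lt_coe_iff.1 h1).le

theorem measurableSet_intervalToSup (D : Set ℝ) : MeasurableSet (intervalToSup D) :=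
  (measurableSet_lt measurable_const measurable_id).inter
    (measurableSet_lt measurable_coe_real_ereal measurable_const)

/-- The maximum principle supplies the normalisation, and with it the factor U^0((0, sup D)) + 1 of
the final estimate. -/
theorem isRenewalSolution_expectedCount (hν : ∀ᵐ y ∂ν, 0 < y) {D : Set ℝ} (hD : MeasurableSet D)
    (hD0 : D ⊆ Set.Ioi 0) (hDb : BddAbove D) :
    IsRenewalSolution ν fun u => (expectedCount ν D u).toReal
      / (expectedCount ν (intervalToSup D) 0 + 1).toReal := by
  have hG : expectedCount ν (intervalToSup D) 0 + 1 ≠ ⊤ :=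
    ENNReal.add_ne_top.2 ⟨(expectedCount_lt_top hν (bddAbove_intervalToSup hDb) 0).ne,
      ENNReal.one_ne_top⟩
  refine ⟨(measurable_expectedCount hD).ennreal_toReal.div_const _, fun u => by positivity,
    fun u => div_le_one_of_le₀ (ENNReal.toReal_mono hG (expectedCount_le_add_one hν hD hD0 hDb u))
      ENNReal.toReal_nonneg, fun u hu => ?_⟩
  have hmeas : Measurable fun y => expectedCount ν D (u - y) :=
    (measurable_expectedCount hD).comp (measurable_const.sub measurable_id)
  rw [integral_div, integral_toReal hmeas.aemeasurable
    (Filter.Eventually.of_forall fun y => expectedCount_lt_top hν hDb _),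
    ← expectedCount_eq_lintegral hD hD0 hu]

end

/-! ### Transfer from sequence space to the given process -/

section Transfer

variable {ν : Measure ℝ} {Ω : Type*} [MeasurableSpace Ω]
  {P : Measure Ω} {X : ℕ → Ω → ℝ}

theorem hasLaw_seqLaw (hX : iIndepFun X P) (hl : ∀ i, HasLaw (X i) ν P) :
    HasLaw (fun ω i => X i ω) (seqLaw ν) P :=
  hX.hasLaw_infinitePi hl (aemeasurable_pi_iff.2 fun i => (hl i).aemeasurable)

theorem map_epoch (h : HasLaw (fun ω i => X i ω) (seqLaw ν) P) (x : ℝ) (n : ℕ) :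
    P.map (epoch X x n) = (seqLaw ν).map (epoch coord x n) := by
  rw [← h.map_eq, AEMeasurable.map_map_of_aemeasurable (measurable_epoch x n).aemeasurable
    h.aemeasurable]
  rfl

theorem map_residualLife_apply [IsProbabilityMeasure ν]
    (h : HasLaw (fun ω i => X i ω) (seqLaw ν) P) (x t : ℝ) {A : Set ℝ}
    (hA : MeasurableSet A) : (P.map (residualLife X x t)).real A
      = (seqLaw ν).real {ω | residualLife coord 0 (t - x) ω ∈ A} := by
  have hm : Measurable (residualLife coord 0 (t - x)) := measurable_residualLife_right (t - x)
  have e : P.map (residualLife X x t) = (seqLaw ν).map (residualLife coord 0 (t - x)) := by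
    have hc : residualLife X x t = residualLife coord 0 (t - x) ∘ fun ω i => X i ω :=
      funext fun ω => (residualLife_eq_sub X x t ω).trans (residualLife_coord X 0 (t - x) ω).symm
    have hm' : AEMeasurable (residualLife coord 0 (t - x)) (P.map fun ω i => X i ω) :=
      hm.aemeasurable
    rw [hc, ← AEMeasurable.map_map_of_aemeasurable hm' h.aemeasurable, h.map_eq]
  rw [e, map_measureReal_apply hm hA]
  rfl

theorem renewalMeasure_image_add (h : HasLaw (fun ω i => X i ω) (seqLaw ν) P) (x : ℝ) {t : ℝ}
    (ht : 0 ≤ t) {D : Set ℝ} (hD : MeasurableSet D) (hD0 : D ⊆ Set.Ioi 0) :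
    renewalMeasure P X x ((fun s => t + s) '' D) = expectedCount ν D (t - x) := by
  have hE : MeasurableSet ((fun s => t + s) '' D) := by
    rw [Set.image_add_left]
    exact measurable_const_add (-t) hD
  have hsub : (fun s => t + s) '' D ∩ Set.Ioi 0 = (fun s => t + s) '' D := by
    refine Set.inter_eq_left.2 ?_
    rintro _ ⟨d, hd, rfl⟩
    have : 0 < d := hD0 hd
    simp only [Set.mem_Ioi]
    linarith
  rw [renewalMeasure, Measure.restrict_apply hE, hsub, Measure.sum_apply _ hE, expectedCount]
  refine tsum_congr fun n => ?_
  rw [map_epoch h, Measure.map_apply (measurable_epoch x n) hE]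
  congr 1
  ext ω
  simp only [Set.image_add_left, Set.mem_preimage, Set.mem_ofPred_eq]
  rw [epoch_eq_add coord x, show -t + (x + epoch coord 0 n ω) = epoch coord 0 n ω - (t - x) by ring]

theorem renewalMeasure_intervalToSup (h : HasLaw (fun ω i => X i ω) (seqLaw ν) P) (D : Set ℝ) :
    renewalMeasure P X 0 (intervalToSup D) = expectedCount ν (intervalToSup D) 0 := by
  have := renewalMeasure_image_add h 0 le_rfl (measurableSet_intervalToSup D) fun s hs => hs.1
  simpa using this

end Transfer

/-! ### Comparison of counts and verification of the constants -/

theorem lintegral_ofReal_exp {ν : Measure ℝ} {b : ℝ} (h : Integrable (fun y => Real.exp (b * y)) ν) :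
    ∫⁻ y, ENNReal.ofReal (Real.exp (b * y)) ∂ν = ENNReal.ofReal (laplace ν b) :=
  (ofReal_integral_eq_lintegral_ofReal h
    (Filter.Eventually.of_forall fun _ => (Real.exp_pos _).le)).symm

theorem expectedCount_eq_iSup {ν : Measure ℝ} {D : Set ℝ} (hD : MeasurableSet D) (u : ℝ) :
    expectedCount ν D u = ⨆ M : ℕ, expectedCount ν (D ∩ Set.Iic (M : ℝ)) u := by
  have hm : ∀ n, Measurable fun ω => epoch coord 0 n ω - u := fun n =>
    (measurable_epoch 0 n).sub_const u
  have key : ∀ {E : Set ℝ}, MeasurableSet E → expectedCount ν E u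
      = Measure.sum (fun n => (seqLaw ν).map fun ω => epoch coord 0 n ω - u) E := by
    intro E hE
    rw [Measure.sum_apply _ hE]
    exact tsum_congr fun n => (Measure.map_apply (hm n) hE).symm
  have hU : D = ⋃ M : ℕ, D ∩ Set.Iic (M : ℝ) := by
    have : ⋃ M : ℕ, Set.Iic (M : ℝ) = Set.univ :=
      Set.iUnion_eq_univ_iff.2 fun x => exists_nat_ge x
    rw [← Set.inter_iUnion, this, Set.inter_univ]
  have hmono : Monotone fun M : ℕ => D ∩ Set.Iic (M : ℝ) := fun M N h =>
    Set.inter_subset_inter_right _ (Set.Iic_subset_Iic.2 (by exact_mod_cast h))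
  conv_lhs => rw [key hD, hU, hmono.measure_iUnion]
  exact iSup_congr fun M => (key (hD.inter measurableSet_Iic)).symm

section

variable {ν : Measure ℝ} [IsProbabilityMeasure ν]

/-- The oscillation bound applies to bounded truncations of D, whose counts are finite. The additive
form survives the supremum over the truncations, even when it is infinite. -/
theorem expectedCount_le_add (hν : ∀ᵐ y ∂ν, 0 < y) {B u v : ℝ}
    (hB : ∀ F, IsRenewalSolution ν F → |F v - F u| ≤ B) {D : Set ℝ} (hD : MeasurableSet D)
    (hD0 : D ⊆ Set.Ioi 0) :
    expectedCount ν D v ≤ expectedCount ν D u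
      + ENNReal.ofReal B * (expectedCount ν (intervalToSup D) 0 + 1) := by
  rw [expectedCount_eq_iSup hD v]
  refine iSup_le fun M => ?_
  set E := D ∩ Set.Iic (M : ℝ) with hE
  have hED : E ⊆ D := Set.inter_subset_left
  have hEb : BddAbove E := bddAbove_Iic.mono Set.inter_subset_right
  set G := expectedCount ν (intervalToSup E) 0 + 1 with hGdef
  have hG : G ≠ ⊤ := ENNReal.add_ne_top.2
    ⟨(expectedCount_lt_top hν (bddAbove_intervalToSup hEb) 0).ne, ENNReal.one_ne_top⟩
  have hG0 : 0 < G.toReal := ENNReal.toReal_pos (by simp [hGdef]) hG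
  have h := hB _ (isRenewalSolution_expectedCount hν (hD.inter measurableSet_Iic)
    (hED.trans hD0) hEb)
  have hB0 : 0 ≤ B := (abs_nonneg _).trans h
  rw [← sub_div, abs_div, abs_of_pos hG0, div_le_iff₀ hG0] at h
  have h2 := (abs_le.1 h).2
  have hu := (expectedCount_lt_top hν hEb u).ne
  have hv := (expectedCount_lt_top hν hEb v).ne
  calc expectedCount ν E v = ENNReal.ofReal (expectedCount ν E v).toReal :=
        (ENNReal.ofReal_toReal hv).symm
    _ ≤ ENNReal.ofReal ((expectedCount ν E u).toReal + B * G.toReal) :=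
        ENNReal.ofReal_le_ofReal (by linarith)
    _ = expectedCount ν E u + ENNReal.ofReal B * G := by
        rw [ENNReal.ofReal_add ENNReal.toReal_nonneg (by positivity), ENNReal.ofReal_mul hB0,
          ENNReal.ofReal_toReal hu, ENNReal.ofReal_toReal hG]
    _ ≤ _ := by
        gcongr
        · exact expectedCount_mono ν hED u
        · exact add_le_add_left (expectedCount_mono ν (intervalToSup_mono hED) 0) 1

theorem integrable_exp_of_nonpos (hν : ∀ᵐ y ∂ν, 0 < y) {b : ℝ} (hb : b ≤ 0) :
    Integrable (fun y => Real.exp (b * y)) ν := by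
  refine Integrable.of_bound (by fun_prop) 1 ?_
  filter_upwards [hν] with y hy
  rw [Real.norm_eq_abs, Real.abs_exp, Real.exp_le_one_iff]
  nlinarith

theorem one_le_laplace (hν : ∀ᵐ y ∂ν, 0 < y) {b : ℝ} (hb : 0 ≤ b)
    (h : Integrable (fun y => Real.exp (b * y)) ν) : 1 ≤ laplace ν b := by
  have : ∫ _, (1 : ℝ) ∂ν ≤ ∫ y, Real.exp (b * y) ∂ν := by
    refine integral_mono_ae (integrable_const _) h ?_
    filter_upwards [hν] with y hy
    exact Real.one_le_exp (by positivity)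
  simpa [laplace] using this

theorem radius_pos (hν : ∀ᵐ y ∂ν, 0 < y) {β δ : ℝ} (hβ : 0 < β) (hδ0 : 0 ≤ δ) (hδ1 : δ < 1)
    (h : Integrable (fun y => Real.exp ((1 + δ) * β * y)) ν) : 0 < radius ν δ β := by
  have h1 := one_le_laplace hν (by positivity) h
  have hb : 0 < (1 - δ) * β := mul_pos (sub_pos.2 hδ1) hβ
  have h2 := laplace_neg_lt_one hν hb
  have h3 : 0 < laplace ν (-((1 - δ) * β)) :=
    integral_exp_pos (integrable_exp_of_nonpos hν (by linarith))
  refine mul_pos (by positivity) (Real.log_pos ?_)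
  rw [one_lt_div (by linarith)]
  linarith

/-- The exponential of |d - y| is at most the sum of the exponentials of its two branches, and
`radius` is exactly the threshold beyond which the expected sum is at most exp (β d). Jensen's
inequality passes from β to τβ with the same radius. -/
theorem lintegral_exp_drift_le (hν : ∀ᵐ y ∂ν, 0 < y) {β δ τ d : ℝ} (hβ : 0 < β) (hδ0 : 0 ≤ δ)
    (hδ1 : δ < 1) (hτ0 : 0 ≤ τ) (hτ1 : τ ≤ 1)
    (h : Integrable (fun y => Real.exp ((1 + δ) * β * y)) ν) (hd : radius ν δ β ≤ d) :
    ∫⁻ y, ENNReal.ofReal (Real.exp (τ * β * (|d - y| + δ * y))) ∂ν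
      ≤ ENNReal.ofReal (Real.exp (τ * β * d)) := by
  have h1 := one_le_laplace hν (by positivity) h
  have hb : 0 < (1 - δ) * β := mul_pos (sub_pos.2 hδ1) hβ
  have hl := laplace_neg_lt_one hν hb
  have hi := integrable_exp_of_nonpos (ν := ν) hν (neg_nonpos.2 hb.le)
  set l₁ := laplace ν (-((1 - δ) * β))
  set l₂ := laplace ν ((1 + δ) * β)
  have hl0 : 0 ≤ l₁ := laplace_nonneg ν _
  have hkey : Real.exp (β * d) * l₁ + Real.exp (-(β * d)) * l₂ ≤ Real.exp (β * d) := by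
    have hlog : Real.log (l₂ / (1 - l₁)) ≤ 2 * β * d := by
      have : 1 / (2 * β) * Real.log (l₂ / (1 - l₁)) ≤ d := hd
      rwa [one_div, inv_mul_le_iff₀ (by positivity)] at this
    have hpos : 0 < 1 - l₁ := by linarith
    have h3 : l₂ ≤ Real.exp (2 * β * d) * (1 - l₁) :=
      (div_le_iff₀ hpos).1 ((Real.log_le_iff_le_exp (div_pos (by linarith) hpos)).1 hlog)
    have h4 : Real.exp (-(β * d)) * l₂
        ≤ Real.exp (-(β * d)) * (Real.exp (2 * β * d) * (1 - l₁)) := by gcongr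
    rw [← mul_assoc, ← Real.exp_add, show -(β * d) + 2 * β * d = β * d by ring] at h4
    linarith
  have hmain : ∫⁻ y, ENNReal.ofReal (Real.exp (β * (|d - y| + δ * y))) ∂ν
      ≤ ENNReal.ofReal (Real.exp (β * d)) := by
    calc ∫⁻ y, ENNReal.ofReal (Real.exp (β * (|d - y| + δ * y))) ∂ν
        ≤ ∫⁻ y, (ENNReal.ofReal (Real.exp (β * d))
              * ENNReal.ofReal (Real.exp (-((1 - δ) * β) * y))
            + ENNReal.ofReal (Real.exp (-(β * d)))
              * ENNReal.ofReal (Real.exp ((1 + δ) * β * y))) ∂ν := by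
          refine lintegral_mono fun y => ?_
          dsimp only
          rw [← ENNReal.ofReal_mul (Real.exp_pos _).le, ← ENNReal.ofReal_mul (Real.exp_pos _).le,
            ← ENNReal.ofReal_add (by positivity) (by positivity), ← Real.exp_add, ← Real.exp_add]
          refine ENNReal.ofReal_le_ofReal ?_
          rcases abs_cases (d - y) with ⟨e, _⟩ | ⟨e, _⟩
          · rw [e, show β * (d - y + δ * y) = β * d + -((1 - δ) * β) * y by ring]
            exact le_add_of_nonneg_right (Real.exp_pos _).le
          · rw [e, show β * (-(d - y) + δ * y) = -(β * d) + (1 + δ) * β * y by ring]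
            exact le_add_of_nonneg_left (Real.exp_pos _).le
      _ = ENNReal.ofReal (Real.exp (β * d) * l₁ + Real.exp (-(β * d)) * l₂) := by
          rw [lintegral_add_left (by fun_prop), lintegral_const_mul _ (by fun_prop),
            lintegral_const_mul _ (by fun_prop), lintegral_ofReal_exp hi, lintegral_ofReal_exp h,
            ← ENNReal.ofReal_mul (Real.exp_pos _).le, ← ENNReal.ofReal_mul (Real.exp_pos _).le,
            ← ENNReal.ofReal_add (by positivity) (by positivity)]
      _ ≤ _ := ENNReal.ofReal_le_ofReal hkey
  have hpow : ∀ z : ℝ, ENNReal.ofReal (Real.exp (τ * β * z))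
      = ENNReal.ofReal (Real.exp (β * z)) ^ τ := by
    intro z
    rw [ENNReal.ofReal_rpow_of_pos (Real.exp_pos _), ← Real.exp_mul]
    ring_nf
  simp only [hpow]
  exact (lintegral_rpow_le_rpow_lintegral (by fun_prop) hτ0 hτ1).trans
    (ENNReal.rpow_le_rpow hmain hτ0)

theorem ofReal_exp_le_laplaceMax {a s : ℝ} (hs : 0 ≤ s) (ha : ν (Set.Ioi a) ≠ 0) :
    ENNReal.ofReal (Real.exp (s * a)) ≤ laplaceMax ν a s := by
  have hP : IsProbabilityMeasure (ν[|Set.Ioi a]) := cond_isProbabilityMeasure ha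
  have hae : ∀ᵐ y ∂(ν[|Set.Ioi a]), y ∈ Set.Ioi a := ae_cond_mem measurableSet_Ioi
  calc ENNReal.ofReal (Real.exp (s * a))
      = ∫⁻ _ : ℝ × ℝ, ENNReal.ofReal (Real.exp (s * a))
          ∂((ν[|Set.Ioi a]).prod (ν[|Set.Ioi a])) := by simp
    _ ≤ _ := by
      refine lintegral_mono_ae ?_
      filter_upwards [Measure.quasiMeasurePreserving_fst.ae hae] with z hz
      have : a ≤ max z.1 z.2 := (le_of_lt hz).trans (le_max_left _ _)
      gcongr

theorem laplaceMax_mul_le_rpow {a s κ : ℝ} (ha : ν (Set.Ioi a) ≠ 0) (hκ0 : 0 ≤ κ) (hκ1 : κ ≤ 1) :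
    laplaceMax ν a (κ * s) ≤ laplaceMax ν a s ^ κ := by
  have hP : IsProbabilityMeasure (ν[|Set.Ioi a]) := cond_isProbabilityMeasure ha
  have hpow : ∀ z : ℝ, ENNReal.ofReal (Real.exp (κ * s * z))
      = ENNReal.ofReal (Real.exp (s * z)) ^ κ := by
    intro z
    rw [ENNReal.ofReal_rpow_of_pos (Real.exp_pos _), ← Real.exp_mul]
    ring_nf
  simp only [laplaceMax, hpow]
  exact lintegral_rpow_le_rpow_lintegral (by fun_prop) hκ0 hκ1

/-- A constant for the coupling argument that is bounded uniformly in the law `ν`; it is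
obtained by lowering the exponent `θ` to `κ θ`. -/
theorem exists_couplingData (hν : ∀ᵐ y ∂ν, 0 < y) {ηt c L β δ θ κ : ℝ}
    (hη0 : 0 < ηt) (hη1 : ηt < 1) (hL : 0 < L) (hLc : L ≤ c) (hβ : 0 < β) (hδ0 : 0 ≤ δ)
    (hδ1 : δ < 1) (hθ0 : 0 < θ) (hθ1 : θ ≤ 1) (hκ0 : 0 ≤ κ) (hκ1 : κ < 1)
    (hU : HasUniformComponent ν c L ηt) (htail : 0 < ν (Set.Ioi (c + L)))
    (hint : Integrable (fun y => Real.exp ((1 + δ) * β * y)) ν)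
    (hadm : Admissible ν (ηt / 2) c L β δ θ) :
    ∃ Λ C : ℝ, CouplingData ν ηt c L (κ * (θ * β)) δ (radius ν δ β) Λ C ∧
      C ≤ couplingConstant ν (ηt / 2) c L β δ θ ∧
      C ≤ 1 / (1 - ηt / 2) / (1 - Real.exp (-((1 - κ) * (θ * β * (c + L))))) := by
  set R := radius ν δ β with hRdef
  have hR : 0 < R := radius_pos hν hβ hδ0 hδ1 hint
  set s := θ * β with hs
  have hs0 : 0 < s := mul_pos hθ0 hβ
  have hc : 0 < c := hL.trans_le hLc
  set k := ⌈R / L⌉₊ with hk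
  have hk0 : k ≠ 0 := (Nat.ceil_pos.2 (div_pos hR hL)).ne'
  set p := (ηt / 2) ^ k with hp
  have hp0 : 0 < p := by positivity
  have hpη : p ≤ ηt / 2 := pow_le_of_le_one (by positivity) (by linarith) hk0
  set W := R + (⌊R / L⌋₊ : ℝ) * c with hW
  have hRW : R ≤ W := le_add_of_nonneg_right (by positivity)
  have hWk : 0 < W := hR.trans_le hRW
  set A := (attemptCost ν c L R s).toReal with hA
  have hAlt : attemptCost ν c L R s * ENNReal.ofReal (1 - p) < 1 := hadm
  have hq0 : 0 < 1 - p := by linarith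
  have hAtop : attemptCost ν c L R s ≠ ⊤ := by
    intro h
    rw [h, ENNReal.top_mul (by simpa using hq0)] at hAlt
    exact absurd hAlt (by simp)
  have hAq : A * (1 - p) < 1 := by
    have := (ENNReal.toReal_lt_toReal (ENNReal.mul_ne_top hAtop ENNReal.ofReal_ne_top)
      ENNReal.one_ne_top).2 hAlt
    rwa [ENNReal.toReal_mul, ENNReal.toReal_ofReal hq0.le, ENNReal.toReal_one] at this
  have hΛ0top : laplaceMax ν (c + L) s ≠ ⊤ := by
    intro h
    refine hAtop ?_
    rw [attemptCost, h, ENNReal.mul_top (by simpa using Real.exp_pos _)]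
  set Λ := (laplaceMax ν (c + L) s).toReal
  have hAeq : A = Real.exp (s * W) * Λ := by
    rw [hA, attemptCost, ENNReal.toReal_mul, ENNReal.toReal_ofReal (Real.exp_pos _).le]
  have hΛle : Real.exp (s * (c + L)) ≤ Λ :=
    (ENNReal.ofReal_le_iff_le_toReal hΛ0top).1 (ofReal_exp_le_laplaceMax hs0.le htail.ne')
  have hEA : Real.exp (s * (c + L)) ≤ A := by
    rw [hAeq]
    exact hΛle.trans (le_mul_of_one_le_left ((Real.exp_pos _).le.trans hΛle)
      (Real.one_le_exp (by positivity)))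
  have hA1 : 1 < A := (Real.one_lt_exp_iff.2 (by positivity)).trans_le hEA
  have hΛ0 : 0 ≤ Λ := ENNReal.toReal_nonneg
  have hpowle := laplaceMax_mul_le_rpow (s := s) htail.ne' hκ0 hκ1.le
  have hpowtop : laplaceMax ν (c + L) s ^ κ ≠ ⊤ := ENNReal.rpow_ne_top_of_nonneg hκ0 hΛ0top
  have hΛ'top : laplaceMax ν (c + L) (κ * s) ≠ ⊤ := ne_top_of_le_ne_top hpowtop hpowle
  set Λ' := (laplaceMax ν (c + L) (κ * s)).toReal
  have hΛ'le : Λ' ≤ Λ ^ κ := by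
    have := ENNReal.toReal_mono hpowtop hpowle
    rwa [← ENNReal.toReal_rpow] at this
  have hΛ'1 : 1 ≤ Λ' := by
    refine (Real.one_le_exp (by positivity : 0 ≤ κ * s * (c + L))).trans ?_
    exact (ENNReal.ofReal_le_iff_le_toReal hΛ'top).1
      (ofReal_exp_le_laplaceMax (by positivity) htail.ne')
  set A' := Real.exp (κ * s * W) * Λ' with hA'
  have hE'1 : 1 ≤ Real.exp (κ * s * W) := Real.one_le_exp (by positivity)
  have hA'1 : 1 ≤ A' := one_le_mul_of_one_le_of_one_le hE'1 hΛ'1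
  have hA'pow : A' ≤ A ^ κ := by
    rw [hAeq, Real.mul_rpow (Real.exp_pos _).le hΛ0, ← Real.exp_mul,
      show s * W * κ = κ * s * W by ring]
    exact mul_le_mul_of_nonneg_left hΛ'le (Real.exp_pos _).le
  have hA'A : A' ≤ A := hA'pow.trans (by
    simpa using Real.rpow_le_rpow_of_exponent_le hA1.le hκ1.le)
  have hA'q : A' * (1 - p) < 1 := (by gcongr : A' * (1 - p) ≤ A * (1 - p)).trans_lt hAq
  have hden : 0 < 1 - A' * (1 - p) := by linarith
  -- The fixed point of C ↦ ((1 - p) C + p) A', so that `attempt_le` holds with equality.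
  set C := p * A' / (1 - A' * (1 - p)) with hC
  have hA'C : A' ≤ C := by
    rw [hC, le_div_iff₀ hden, mul_comm p]
    have : 1 - p ≤ A' * (1 - p) := le_mul_of_one_le_left hq0.le hA'1
    exact mul_le_mul_of_nonneg_left (by linarith) (by linarith)
  refine ⟨Λ', C, ?_, ?_, ?_⟩
  · refine ⟨hν, hU.uniformPart_le hη0.le hL hLc, hη0, hη1, hL, hLc, by positivity, hδ0, hδ1.le,
      hR, htail.ne', (ENNReal.ofReal_toReal hΛ'top).symm, hΛ'1, ?_, ?_, ?_⟩
    · refine le_trans ?_ hA'C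
      have : Real.exp (κ * s * R) ≤ Real.exp (κ * s * W) := by gcongr
      exact this.trans (le_mul_of_one_le_right (Real.exp_pos _).le hΛ'1)
    · change ((1 - p) * C + p) * A' ≤ C
      have : C * (1 - A' * (1 - p)) = p * A' := div_mul_cancel₀ _ hden.ne'
      linarith
    · intro d hd
      have := lintegral_exp_drift_le hν (τ := κ * θ) hβ hδ0 hδ1 (by positivity)
        (by nlinarith) hint hd
      rwa [mul_assoc κ θ β] at this
  · change p * A' / (1 - A' * (1 - p)) ≤ p * A / (1 - A * (1 - p))
    gcongr
  · have hx : Real.exp (-((1 - κ) * (s * (c + L)))) < 1 := by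
      rw [Real.exp_lt_one_iff, neg_lt_zero]
      exact mul_pos (by linarith) (by positivity)
    -- From A' (1 - p) < 1 and p ≤ η.
    have hnum : p * A' ≤ 1 / (1 - ηt / 2) := by
      rw [le_div_iff₀ (by linarith)]
      nlinarith
    -- Admissibility leaves the factor A ^ (κ - 1), and A ≥ exp (s (c + L)) with κ < 1 turns it into
    -- a gap below 1 that does not depend on `ν`.
    have hdenle : A' * (1 - p) ≤ Real.exp (-((1 - κ) * (s * (c + L)))) := by
      calc A' * (1 - p) ≤ A ^ κ * (1 - p) := by gcongr
        _ = A ^ (κ - 1) * (A * (1 - p)) := by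
          rw [Real.rpow_sub_one (by linarith)]
          field_simp
        _ ≤ A ^ (κ - 1) * 1 := by gcongr
        _ ≤ Real.exp (s * (c + L)) ^ (κ - 1) := by
          rw [mul_one]
          exact Real.rpow_le_rpow_of_nonpos (Real.exp_pos _) hEA (by linarith)
        _ = _ := by
          rw [← Real.exp_mul]
          ring_nf
    have : 0 ≤ 1 / (1 - ηt / 2) := one_div_nonneg.2 (by linarith)
    rw [hC]
    gcongr

end

end Renewal

/-! ### Choice of the rate and conclusion -/

theorem corollary1p2 (ηt c L β δ θ γ : ℝ)
    (hη0 : 0 < ηt) (hη1 : ηt < 1) (hL : 0 < L) (hLc : L ≤ c)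
    (hβ : 0 < β) (hδ0 : 0 ≤ δ) (hδ1 : δ < 1) (hθ0 : 0 < θ) (hθ1 : θ ≤ 1)
    (hγ : γ < β * θ * δ) :
    ∃ K : ℝ, ∀ (ν : Measure ℝ) [IsProbabilityMeasure ν],
      (∀ᵐ y ∂ν, 0 < y) →
      Renewal.HasUniformComponent ν c L ηt →
      0 < ν (Set.Ioi (c + L)) →
      Integrable (fun y => Real.exp ((1 + δ) * β * y)) ν →
      Renewal.Admissible ν (ηt / 2) c L β δ θ →
      ∃ C : ℝ, C ≤ Renewal.couplingConstant ν (ηt / 2) c L β δ θ ∧ C ≤ K ∧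
        ∀ {Ω : Type*} [MeasurableSpace Ω] (P : Measure Ω) [IsProbabilityMeasure P]
          (X : ℕ → Ω → ℝ), iIndepFun X P → (∀ i, HasLaw (X i) ν P) →
          ∀ x t : ℝ, 0 ≤ x → 0 ≤ t →
            Renewal.tvDist (P.map (Renewal.residualLife X x t))
                (P.map (Renewal.residualLife X 0 t))
              ≤ Real.exp (β * θ * x) * C * Real.exp (-γ * t) ∧
            ∀ D : Set ℝ, MeasurableSet D → D ⊆ Set.Ioi 0 →
              (BddAbove D →
                Renewal.renewalMeasure P X x ((fun s => t + s) '' D) < ⊤ ∧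
                Renewal.renewalMeasure P X 0 ((fun s => t + s) '' D) < ⊤ ∧
                Renewal.renewalMeasure P X 0 (Renewal.intervalToSup D) < ⊤) ∧
              Renewal.renewalMeasure P X x ((fun s => t + s) '' D)
                ≤ Renewal.renewalMeasure P X 0 ((fun s => t + s) '' D) +
                  ENNReal.ofReal (2 * Real.exp (β * θ * x) * C * Real.exp (-γ * t)) *
                    (Renewal.renewalMeasure P X 0 (Renewal.intervalToSup D) + 1) ∧
              Renewal.renewalMeasure P X 0 ((fun s => t + s) '' D)
                ≤ Renewal.renewalMeasure P X x ((fun s => t + s) '' D) +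
                  ENNReal.ofReal (2 * Real.exp (β * θ * x) * C * Real.exp (-γ * t)) *
                    (Renewal.renewalMeasure P X 0 (Renewal.intervalToSup D) + 1) := by
  -- The least κ ≥ 0 with κθβδ ≥ γ. For δ = 0 the quotient is 0 by convention, and γ < 0.
  set κ := max 0 (γ / (β * θ * δ)) with hκ
  have hκ0 : 0 ≤ κ := le_max_left _ _
  have hκ1 : κ < 1 := by
    refine max_lt one_pos ?_
    rcases hδ0.eq_or_lt with h | h
    · simp [← h]
    · rwa [div_lt_one (by positivity)]
  have hγκ : γ ≤ κ * (θ * β) * δ := by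
    rcases hδ0.eq_or_lt with h | h
    · rw [← h] at hγ ⊢
      linarith
    · have h1 : γ / (β * θ * δ) ≤ κ := le_max_right _ _
      rw [div_le_iff₀ (by positivity)] at h1
      linarith
  refine ⟨1 / (1 - ηt / 2) / (1 - Real.exp (-((1 - κ) * (θ * β * (c + L))))), ?_⟩
  intro ν _ hν hU htail hint hadm
  obtain ⟨Λ, C, S, hC1, hC2⟩ := Renewal.exists_couplingData hν hη0 hη1 hL hLc hβ hδ0 hδ1 hθ0 hθ1
    hκ0 hκ1 hU htail hint hadm
  refine ⟨C, hC1, hC2, ?_⟩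
  intro Ω _ P _ X hX hlaw x t hx ht
  have hlaw' := Renewal.hasLaw_seqLaw hX hlaw
  have hCpos : 0 < C := one_pos.trans_le S.one_le_C
  set B := Real.exp (β * θ * x) * C * Real.exp (-γ * t) with hBdef
  have hB0 : 0 ≤ B := by positivity
  have hB : ∀ F, Renewal.IsRenewalSolution ν F → |F (t - x) - F (t - 0)| ≤ B := by
    intro F hF
    rw [sub_zero]
    refine (S.abs_sub_le_exp hF hx t).trans ?_
    have h1 : κ * (θ * β) * x ≤ β * θ * x := by
      refine mul_le_mul_of_nonneg_right ?_ hx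
      rw [mul_comm β]
      exact mul_le_of_le_one_left (by positivity) hκ1.le
    have h2 : -(κ * (θ * β) * δ * t) ≤ -γ * t := by
      have := mul_le_mul_of_nonneg_right hγκ ht
      linarith
    rw [hBdef]
    gcongr
  have hB' : ∀ F, Renewal.IsRenewalSolution ν F → |F (t - 0) - F (t - x)| ≤ B := fun F hF => by
    rw [abs_sub_comm]
    exact hB F hF
  -- The factor 2 is slack: the normalised count has values in [0, 1], so the oscillation bound
  -- applies to it directly.
  have h2B : ENNReal.ofReal B
      ≤ ENNReal.ofReal (2 * Real.exp (β * θ * x) * C * Real.exp (-γ * t)) := by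
    refine ENNReal.ofReal_le_ofReal ?_
    linarith
  refine ⟨ciSup_le fun A => ?_, fun D hD hD0 => ?_⟩
  · rw [Renewal.map_residualLife_apply hlaw' x t A.2, Renewal.map_residualLife_apply hlaw' 0 t A.2]
    exact hB _ (Renewal.isRenewalSolution_residualLife hν A.2)
  · rw [Renewal.renewalMeasure_image_add hlaw' x ht hD hD0,
      Renewal.renewalMeasure_image_add hlaw' 0 ht hD hD0,
      Renewal.renewalMeasure_intervalToSup hlaw']
    refine ⟨fun hb => ⟨Renewal.expectedCount_lt_top hν hb _, Renewal.expectedCount_lt_top hν hb _,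
      Renewal.expectedCount_lt_top hν (Renewal.bddAbove_intervalToSup hb) _⟩, ?_, ?_⟩
    · exact (Renewal.expectedCount_le_add hν hB hD hD0).trans (by gcongr)
    · exact (Renewal.expectedCount_le_add hν hB' hD hD0).trans (by gcongr)
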